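/- Two robots $R_1,R_2$ start at the center $O$ of the closed unit disk and move at unit speed; an unknown exit lies on the boundary circle. Fix a point $I$ of the circle and parameters $p_1,\alpha_1,d_1,p_2,\alpha_2,d_2$. As long as the exit is unknown, the robots follow these trajectories, which are mirror images of each other in the line $OI$: both robots move straight to $I$, and from there $R_1$ moves counter-clockwise and $R_2$ clockwise along the circle. When each has covered the arc length $p_1$ (at points $C_1$, $C_1'$ respectively), each moves a distance $d_1$ into the disk along a straight line making the angle $\alpha_1$, towards the side of $I$, with the chord $C_1C_1'$, returns along the same segment (first cut), and continues the search on the circle. When each has covered the total arc length $p_2$ on the circle (at $C_2$, $C_2'$), each performs in the same way a second cut of depth $d_2$ at angle $\alpha_2$ to the chord $C_2C_2'$, and then continues the search on the circle. If one robot finds the exit at a point $E$ at time $t_0$, let $t\ge 0$ be the least number such that the position $M$ of the other robot at time $t_0+t$ satisfies $|EM|=t$; the robots meet at $M$ at time $t_0+t$, and the evacuation time of this exit is $t_0+2t$. A point of the circle is found when the first robot reaches it. Besides the points of the circle, allow as exit positions, for each robot, two artificial copies of the points where its first and its second cut begin and end: the exit lies at that point, but that robot finds it only immediately after performing the cut,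 i.e. at time $1+p_1+2d_1$, respectively $1+p_2+2d_1+2d_2$. For $R_1$ these copies are denoted $E_3^{\sim}$ (at $C_1$) and $E_5^{\sim}$ (at $C_2$). A worst-case exit position is an exit position of maximal evacuation time. **Theorem.** Let $p_1=2.62666582851$, $\alpha_1=2\pi/9$, $d_1=0.490011696287$, $p_2=2.97374843355$, $\alpha_2=0.05523991\,\pi$, $d_2=0.1670474016$. On the closed half circle searched by $R_1$ (from $I$ to its antipode) there are unique points $E_1,E_2,E_4$ such that for an exit at $E_1$ robot $R_2$ is picked up at $C_1'$ at the beginning of its first cut (at time $1+p_1$), for an exit at $E_2$ it is picked up at $C_1'$ after completing its first cut (at time $1+p_1+2d_1$), and for an exit at $E_4$ it is picked up at $C_2'$ after completing its second cut (at time $1+p_2+2d_1+2d_2$). Their arc distances $x_1,x_2,x_4$ from $I$ satisfy $0<x_1<x_2<p_1<x_4<p_2$. A worst-case exit position exists, and every worst-case exit position is, up to reflection in the line $OI$ (which exchanges the two robots), one of $E_1$, $E_2$, $E_3^{\sim}$, $E_4$, $E_5^{\sim}$. -/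

import Mathlib

noncomputable section

namespace DiskEvacuation

/-- The six parameters of the two-cut algorithm: position (arc length from the start point),
angle and depth of the first and of the second cut. -/
structure Params where
  p1 : ℝ
  α1 : ℝ
  d1 : ℝ
  p2 : ℝ
  α2 : ℝ
  d2 : ℝ

/-- The concrete parameter values of the analysed algorithm. -/
def Params.star : Params where
  p1 := 2.62666582851
  α1 := 2 * Real.pi / 9
  d1 := 0.490011696287
  p2 := 2.97374843355
  α2 := 0.05523991 * Real.pi
  d2 := 0.1670474016

/-- The two robots. `R1` searches counter-clockwise, `R2` clockwise. -/
inductive Robot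
  | R1
  | R2

/-- The partner of a robot. -/
def Robot.other : Robot → Robot
  | .R1 => .R2
  | .R2 => .R1

/-- The point of the unit circle that a robot has reached after searching an arc of length `x`
starting from `I`. -/
def arcPoint (I : Circle) : Robot → ℝ → Circle
  | .R1, x => I * Circle.exp x
  | .R2, x => I * Circle.exp (-x)

/-- Direction, in the frame where the start point `I` is `1` (seen from the center `0`), of a cut
of the counter-clockwise robot with angle `α`. A cut is started by the two robots at mirror-image
points `C` and `C'`, and `α` is the angle between the cut and the chord from `C` to `C'`, turned
towards the side of `I`. In this frame that chord points in the direction `-i`, and the cut in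
the direction `sin α - i cos α`. -/
def cutDir (α : ℝ) : ℂ := ⟨Real.sin α, -Real.cos α⟩

/-- Position at time `t ≥ 0` of the counter-clockwise robot (as long as the exit is unknown to
it), in the frame where the center of the disk is `0` and the start point `I` is `1`. -/
def track (A : Params) (t : ℝ) : ℂ :=
  -- straight from the center to `I`
  if t ≤ 1 then (t : ℂ)
  -- search until the arc length is `p1`
  else if t ≤ 1 + A.p1 then (Circle.exp (t - 1) : ℂ)
  -- first cut, inwards and back
  else if t ≤ 1 + A.p1 + A.d1 then
    (Circle.exp A.p1 : ℂ) + ((t - (1 + A.p1) : ℝ) : ℂ) * cutDir A.α1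
  else if t ≤ 1 + A.p1 + 2 * A.d1 then
    (Circle.exp A.p1 : ℂ) + ((1 + A.p1 + 2 * A.d1 - t : ℝ) : ℂ) * cutDir A.α1
  -- search until the total arc length is `p2`
  else if t ≤ 1 + A.p2 + 2 * A.d1 then (Circle.exp (t - 1 - 2 * A.d1) : ℂ)
  -- second cut, inwards and back
  else if t ≤ 1 + A.p2 + 2 * A.d1 + A.d2 then
    (Circle.exp A.p2 : ℂ) + ((t - (1 + A.p2 + 2 * A.d1) : ℝ) : ℂ) * cutDir A.α2
  else if t ≤ 1 + A.p2 + 2 * A.d1 + 2 * A.d2 then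
    (Circle.exp A.p2 : ℂ) + ((1 + A.p2 + 2 * A.d1 + 2 * A.d2 - t : ℝ) : ℂ) * cutDir A.α2
  -- continue the search
  else (Circle.exp (t - 1 - 2 * A.d1 - 2 * A.d2) : ℂ)

/-- Position of a robot at time `t ≥ 0` as long as the exit is unknown to it; the closed disk is
the closed unit disk of `ℂ`. The two trajectories are mirror images in the line through `0`
and `I`. -/
def pos (A : Params) (I : Circle) : Robot → ℝ → ℂ
  | .R1, t => (I : ℂ) * track A t
  | .R2, t => (I : ℂ) * (starRingEnd ℂ) (track A t)

/-- Exit positions: the points of the boundary circle, together with the artificial copies of the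
points at which the two robots perform their cuts. For the artificial exit `afterCut1 k`
(`afterCut2 k`), which lies where robot `k` starts and ends its first (second) cut, robot `k`
finds the exit only immediately after performing that cut. -/
inductive ExitPos
  | boundary (E : Circle)
  | afterCut1 (k : Robot)
  | afterCut2 (k : Robot)

/-- The point of the circle at which an exit is located. -/
def ExitPos.point (A : Params) (I : Circle) : ExitPos → Circle
  | .boundary E => E
  | .afterCut1 k => arcPoint I k A.p1
  | .afterCut2 k => arcPoint I k A.p2

/-- The time at which the exit is found. A boundary exit is found when the first
robot reaches it. -/
def foundAt (A : Params) (I : Circle) : ExitPos → ℝ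
  | .boundary E => sInf {t : ℝ | 0 ≤ t ∧ ∃ k : Robot, pos A I k t = (E : ℂ)}
  | .afterCut1 _ => 1 + A.p1 + 2 * A.d1
  | .afterCut2 _ => 1 + A.p2 + 2 * A.d1 + 2 * A.d2

open Classical in
/-- The robot that finds the exit (`R1` if both robots find it simultaneously). -/
def finder (A : Params) (I : Circle) : ExitPos → Robot
  | .boundary E =>
      if pos A I .R1 (foundAt A I (.boundary E)) = (E : ℂ) then .R1 else .R2
  | .afterCut1 k => k
  | .afterCut2 k => k

/-- Meeting protocol: the shortest additional time `t` such that the other robot is at time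
`foundAt + t` at a point whose distance from the exit is `t`. -/
def pickupDelay (A : Params) (I : Circle) (X : ExitPos) : ℝ :=
  sInf {t : ℝ | 0 ≤ t ∧
    dist (X.point A I : ℂ) (pos A I (finder A I X).other (foundAt A I X + t)) = t}

/-- The time at which the robot that finds the exit picks up the other robot. -/
def meetingTime (A : Params) (I : Circle) (X : ExitPos) : ℝ :=
  foundAt A I X + pickupDelay A I X

/-- The time at which both robots have reached the exit. -/
def evacTime (A : Params) (I : Circle) (X : ExitPos) : ℝ :=
  foundAt A I X + 2 * pickupDelay A I X

/-- A (global) worst-case exit position. -/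
def IsWorstCase (A : Params) (I : Circle) (X : ExitPos) : Prop :=
  ∀ Y : ExitPos, evacTime A I Y ≤ evacTime A I X

end DiskEvacuation

end

/-!
By the reflection in the line through the center and the start point it suffices to look at exits
at arc distance `x ∈ [0, π]` in the half circle of the finder. Such an exit is found at time
`reachTime A x`, and the pickup delay is the least `t ≥ 0` with `sep A x (t₀ + t) = t`, where
`t₀` is the time at which the exit is found and `sep A x s` is the distance of the exit from the
partner at time `s`.

The intermediate value theorem gives a criterion for upper bounds that needs no knowledge of the
meeting point: if `t₀ + 2 * t = V` and `sep A x (t₀ + t) < t`, then the evacuation time is less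
than `V` (`add_two_mul_delay_lt`). At each of the five candidates the delay is known exactly
(`delay_x1`, `delay_x2`, `delay_afterCut1`, `delay_x4`), or at least satisfies an explicit equation
(the exit after the second cut). Let the candidate have arc distance `a`, evacuation time `V` and
meeting time `m`. For the exit at `x = a + s` the criterion asks about the partner at time
`m + s / 2`, which is close to the meeting point of the candidate. If the partner is then searching,
both distances are chords and the criterion compares two sines; if it is in a cut, squaring the
distance leaves an inequality whose sides both contain the factor `s`
(`cut1_out_ineq`, `cut1_back_ineq`, `cut2_out_ineq`, `cut2_back_ineq`). In this way each candidate
beats all exits on one or both sides of it, up to the next change in the motion of the partner: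

* `E₁` beats the exits between the start point and the one for which the partner is picked up at
  the inner end of its first cut, and `E₂` those from there up to the first cut of the finder;
* the exit found immediately after the first cut beats the following ones for which the partner is
  picked up on its way into the second cut, and `E₄` those from there up to the second cut;
* the exit found immediately after the second cut beats all later ones.

In both of the first two items the two stretches would share an end point if the two candidates had
equal evacuation times. As these times agree only approximately, the first of the two stretches is
extended slightly beyond the turning point of the partner, which the margin in its inequality
allows.

So the candidates beat all other exits, and the best of these finitely many is a worst case. No
comparison of the candidates with each other is needed.
-/

namespace DiskEvacuation

open Real

noncomputable section

/-! ### Chords -/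

/-- A chord of the unit circle, with one end reflected in the real axis. -/
theorem dist_exp_conj_exp (a b : ℝ) :
    dist (Circle.exp a : ℂ) ((starRingEnd ℂ) (Circle.exp b : ℂ)) = 2 * |sin ((a + b) / 2)| := by
  rw [← sq_eq_sq₀ dist_nonneg (by positivity), dist_eq_norm, Complex.sq_norm, Complex.normSq_apply]
  simp only [Circle.coe_exp, Complex.sub_re, Complex.sub_im, Complex.conj_re, Complex.conj_im,
    Complex.exp_ofReal_mul_I_re, Complex.exp_ofReal_mul_I_im]
  rw [mul_pow, sq_abs, sin_sq_eq_half_sub, mul_div_cancel₀ _ two_ne_zero, cos_add]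
  linear_combination cos_sq_add_sin_sq a + cos_sq_add_sin_sq b

theorem dist_exp_exp (a b : ℝ) :
    dist (Circle.exp a : ℂ) (Circle.exp b : ℂ) = 2 * |sin ((a - b) / 2)| := by
  have h := dist_exp_conj_exp a (-b)
  rwa [Circle.exp_neg, Circle.coe_inv_eq_conj, Complex.conj_conj, ← sub_eq_add_neg] at h

theorem dist_exp_exp_le (a b : ℝ) :
    dist (Circle.exp a : ℂ) (Circle.exp b : ℂ) ≤ |a - b| := by
  rw [dist_exp_exp]
  have := abs_sin_le_abs (x := (a - b) / 2)
  rw [abs_div, abs_two] at this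
  linarith

theorem norm_cutDir (α : ℝ) : ‖cutDir α‖ = 1 := by
  rw [← sq_eq_sq₀ (norm_nonneg _) zero_le_one, Complex.sq_norm, Complex.normSq_apply]
  simp only [cutDir]
  linear_combination cos_sq_add_sin_sq α

/-- Squared distance from a point of the circle to a point at depth `y` of the mirror image of a
cut. -/
theorem dist_exp_conj_cut_sq (x p y α : ℝ) :
    dist (Circle.exp x : ℂ) ((starRingEnd ℂ) ((Circle.exp p : ℂ) + (y : ℂ) * cutDir α)) ^ 2 =
      2 - 2 * cos (x + p) - 2 * y * (sin (x + α) + sin (p - α)) + y ^ 2 := by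
  rw [dist_eq_norm, Complex.sq_norm, Complex.normSq_apply]
  simp only [Circle.coe_exp, Complex.sub_re, Complex.sub_im, Complex.conj_re, Complex.conj_im,
    Complex.exp_ofReal_mul_I_re, Complex.exp_ofReal_mul_I_im, Complex.add_re, Complex.add_im,
    Complex.re_ofReal_mul, Complex.im_ofReal_mul, cutDir]
  rw [cos_add, sin_add, sin_sub]
  linear_combination cos_sq_add_sin_sq x + cos_sq_add_sin_sq p + y ^ 2 * cos_sq_add_sin_sq α

/-- A cut stays inside the open disk as long as it is shorter than the chord in its direction. -/
theorem norm_cut_lt_one {p y α : ℝ} (h0 : 0 < y) (h : y < 2 * sin (p - α)) :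
    ‖(Circle.exp p : ℂ) + (y : ℂ) * cutDir α‖ < 1 := by
  rw [← sq_lt_sq₀ (norm_nonneg _) zero_le_one, Complex.sq_norm, Complex.normSq_apply]
  simp only [Circle.coe_exp, Complex.exp_ofReal_mul_I_re, Complex.exp_ofReal_mul_I_im,
    Complex.add_re, Complex.add_im, Complex.re_ofReal_mul, Complex.im_ofReal_mul, cutDir]
  rw [sin_sub] at h
  nlinarith [cos_sq_add_sin_sq p, cos_sq_add_sin_sq α, mul_pos h0 (sub_pos.2 h),
    congrArg (y ^ 2 * ·) (cos_sq_add_sin_sq α)]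

/-! ### The trajectory -/

/-- The order relations between the parameters that give the trajectory its shape; the bounds on
`d1` and `d2` say that the cuts do not leave the disk. -/
structure Params.Admissible (A : Params) : Prop where
  p1_pos : 0 < A.p1
  d1_pos : 0 < A.d1
  p1_lt_p2 : A.p1 < A.p2
  p2_lt_pi : A.p2 < π
  d2_pos : 0 < A.d2
  d1_lt : A.d1 < 2 * sin (A.p1 - A.α1)
  d2_lt : A.d2 < 2 * sin (A.p2 - A.α2)

theorem lipschitzWith_ite {f g : ℝ → ℂ} {a : ℝ} (hf : LipschitzWith 1 f) (hg : LipschitzWith 1 g)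
    (h : f a = g a) : LipschitzWith 1 fun t => if t ≤ a then f t else g t := by
  have key : ∀ s t : ℝ, s ≤ a → a ≤ t → dist (f s) (g t) ≤ dist s t := by
    intro s t hs ht
    calc dist (f s) (g t) ≤ dist (f s) (f a) + dist (f a) (g t) := dist_triangle _ _ _
      _ ≤ dist s a + dist a t := by
        rw [h]
        nth_rewrite 1 [← h]
        exact add_le_add (by simpa using hf.dist_le_mul s a) (by simpa using hg.dist_le_mul a t)
      _ = dist s t := by
        rw [Real.dist_eq, Real.dist_eq, Real.dist_eq, abs_of_nonpos (by linarith),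
          abs_of_nonpos (by linarith), abs_of_nonpos (by linarith)]
        ring
  refine LipschitzWith.of_dist_le_mul fun s t => ?_
  rw [NNReal.coe_one, one_mul]
  split_ifs with hs ht ht
  · simpa using hf.dist_le_mul s t
  · exact key s t hs (not_le.1 ht).le
  · rw [dist_comm, dist_comm s]
    exact key t s ht (not_le.1 hs).le
  · simpa using hg.dist_le_mul s t

theorem lipschitzWith_exp_sub (c : ℝ) : LipschitzWith 1 fun t : ℝ => (Circle.exp (t - c) : ℂ) :=
  LipschitzWith.of_dist_le_mul fun s t => by
    simpa [Real.dist_eq] using dist_exp_exp_le (s - c) (t - c)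

theorem lipschitzWith_cut_out (z : ℂ) (c α : ℝ) :
    LipschitzWith 1 fun t : ℝ => z + ((t - c : ℝ) : ℂ) * cutDir α :=
  LipschitzWith.of_dist_le_mul fun s t => by
    rw [dist_add_left, dist_eq_norm, ← sub_mul, norm_mul, norm_cutDir, ← Complex.ofReal_sub,
      Complex.norm_real]
    simp [Real.dist_eq]

theorem lipschitzWith_cut_back (z : ℂ) (c α : ℝ) :
    LipschitzWith 1 fun t : ℝ => z + ((c - t : ℝ) : ℂ) * cutDir α :=
  LipschitzWith.of_dist_le_mul fun s t => by
    rw [dist_add_left, dist_eq_norm, ← sub_mul, norm_mul, norm_cutDir, ← Complex.ofReal_sub,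
      Complex.norm_real]
    simp [Real.dist_eq, abs_sub_comm]

/-- The robots never exceed unit speed. -/
theorem lipschitzWith_track {A : Params} (hA : A.Admissible) : LipschitzWith 1 (track A) := by
  have h1 := hA.p1_pos
  have h2 := hA.d1_pos
  have h3 := hA.p1_lt_p2
  have h4 := hA.d2_pos
  have h0 : LipschitzWith 1 fun t : ℝ => (t : ℂ) :=
    LipschitzWith.of_dist_le_mul fun s t => by simp [dist_eq_norm, ← Complex.ofReal_sub]
  have hlast : LipschitzWith 1 fun t : ℝ => (Circle.exp (t - 1 - 2 * A.d1 - 2 * A.d2) : ℂ) := by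
    simpa only [sub_sub] using lipschitzWith_exp_sub (1 + 2 * A.d1 + 2 * A.d2)
  have hmid : LipschitzWith 1 fun t : ℝ => (Circle.exp (t - 1 - 2 * A.d1) : ℂ) := by
    simpa only [sub_sub] using lipschitzWith_exp_sub (1 + 2 * A.d1)
  refine lipschitzWith_ite h0 (lipschitzWith_ite (lipschitzWith_exp_sub 1)
    (lipschitzWith_ite (lipschitzWith_cut_out _ _ _) (lipschitzWith_ite
    (lipschitzWith_cut_back _ _ _) (lipschitzWith_ite hmid (lipschitzWith_ite
    (lipschitzWith_cut_out _ _ _) (lipschitzWith_ite (lipschitzWith_cut_back _ _ _) hlast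
    ?_) ?_) ?_) ?_) ?_) ?_) ?_
  · simp only [sub_self, Complex.ofReal_zero, zero_mul, add_zero]
    congr 3; ring
  · rw [if_pos (by linarith)]
    congr 3; ring
  · rw [if_pos (by linarith)]
    simp only [sub_self, Complex.ofReal_zero, zero_mul, add_zero]
    congr 3; ring
  · rw [if_pos (by linarith)]
    simp only [sub_self, Complex.ofReal_zero, zero_mul, add_zero]
    congr 3; ring
  · rw [if_pos (by linarith)]
    congr 3; ring
  · rw [if_pos (by linarith)]
    simp only [sub_self, Complex.ofReal_zero, zero_mul, add_zero]
    congr 3; ring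
  · rw [if_pos (by linarith)]
    simp

theorem track_search0 {A : Params} {b : ℝ} (h0 : 0 ≤ b) (h1 : b ≤ A.p1) :
    track A (1 + b) = (Circle.exp b : ℂ) := by
  rw [track]
  rcases h0.eq_or_lt with rfl | h0
  · simp
  · rw [if_neg (by linarith), if_pos (by linarith)]
    congr 3; ring

theorem track_cut1_out {A : Params} (hA : A.Admissible) {y : ℝ} (h0 : 0 ≤ y) (h1 : y ≤ A.d1) :
    track A (1 + A.p1 + y) = (Circle.exp A.p1 : ℂ) + (y : ℂ) * cutDir A.α1 := by
  have := hA.p1_pos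
  rcases h0.eq_or_lt with rfl | h0
  · rw [add_zero, track_search0 hA.p1_pos.le le_rfl]
    simp
  · rw [track, if_neg (by linarith), if_neg (by linarith), if_pos (by linarith)]
    congr 3; ring

theorem track_cut1_back {A : Params} (hA : A.Admissible) {y : ℝ} (h0 : 0 ≤ y) (h1 : y ≤ A.d1) :
    track A (1 + A.p1 + 2 * A.d1 - y) = (Circle.exp A.p1 : ℂ) + (y : ℂ) * cutDir A.α1 := by
  have := hA.p1_pos
  have := hA.d1_pos
  rcases h1.eq_or_lt with rfl | h1
  · rw [← track_cut1_out hA h0 le_rfl]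
    congr 1; ring
  · rw [track, if_neg (by linarith), if_neg (by linarith), if_neg (by linarith),
      if_pos (by linarith)]
    congr 3; ring

theorem track_search1 {A : Params} (hA : A.Admissible) {b : ℝ} (h0 : A.p1 ≤ b) (h1 : b ≤ A.p2) :
    track A (1 + b + 2 * A.d1) = (Circle.exp b : ℂ) := by
  have := hA.p1_pos
  have := hA.d1_pos
  rcases h0.eq_or_lt with rfl | h0
  · rw [← sub_zero (1 + A.p1 + 2 * A.d1), track_cut1_back hA le_rfl hA.d1_pos.le]
    simp
  · rw [track, if_neg (by linarith), if_neg (by linarith), if_neg (by linarith),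
      if_neg (by linarith), if_pos (by linarith)]
    congr 3; ring

theorem track_cut2_out {A : Params} (hA : A.Admissible) {y : ℝ} (h0 : 0 ≤ y) (h1 : y ≤ A.d2) :
    track A (1 + A.p2 + 2 * A.d1 + y) = (Circle.exp A.p2 : ℂ) + (y : ℂ) * cutDir A.α2 := by
  have := hA.p1_pos
  have := hA.d1_pos
  have := hA.p1_lt_p2
  rcases h0.eq_or_lt with rfl | h0
  · rw [add_zero, track_search1 hA hA.p1_lt_p2.le le_rfl]
    simp
  · rw [track, if_neg (by linarith), if_neg (by linarith), if_neg (by linarith),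
      if_neg (by linarith), if_neg (by linarith), if_pos (by linarith)]
    congr 3; ring

theorem track_cut2_back {A : Params} (hA : A.Admissible) {y : ℝ} (h0 : 0 ≤ y) (h1 : y ≤ A.d2) :
    track A (1 + A.p2 + 2 * A.d1 + 2 * A.d2 - y) =
      (Circle.exp A.p2 : ℂ) + (y : ℂ) * cutDir A.α2 := by
  have := hA.p1_pos
  have := hA.d1_pos
  have := hA.p1_lt_p2
  have := hA.d2_pos
  rcases h1.eq_or_lt with rfl | h1
  · rw [← track_cut2_out hA h0 le_rfl]
    congr 1; ring
  · rw [track, if_neg (by linarith), if_neg (by linarith), if_neg (by linarith),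
      if_neg (by linarith), if_neg (by linarith), if_neg (by linarith), if_pos (by linarith)]
    congr 3; ring

theorem track_search2 {A : Params} (hA : A.Admissible) {b : ℝ} (h0 : A.p2 ≤ b) :
    track A (1 + b + 2 * A.d1 + 2 * A.d2) = (Circle.exp b : ℂ) := by
  have := hA.p1_pos
  have := hA.d1_pos
  have := hA.p1_lt_p2
  have := hA.d2_pos
  rcases h0.eq_or_lt with rfl | h0
  · rw [← sub_zero (1 + A.p2 + 2 * A.d1 + 2 * A.d2), track_cut2_back hA le_rfl hA.d2_pos.le]
    simp
  · rw [track, if_neg (by linarith), if_neg (by linarith), if_neg (by linarith),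
      if_neg (by linarith), if_neg (by linarith), if_neg (by linarith), if_neg (by linarith)]
    congr 3; ring

/-! ### When and by whom an exit is found -/

/-- The time at which a robot that starts in `0` reaches for the first time the point of the
circle at arc distance `x` from the start point of the search. -/
def reachTime (A : Params) (x : ℝ) : ℝ :=
  if x ≤ A.p1 then 1 + x else if x ≤ A.p2 then 1 + x + 2 * A.d1 else 1 + x + 2 * A.d1 + 2 * A.d2

theorem reachTime_of_le {A : Params} {x : ℝ} (h : x ≤ A.p1) : reachTime A x = 1 + x := if_pos h

theorem reachTime_of_lt_of_le {A : Params} {x : ℝ} (h : A.p1 < x) (h' : x ≤ A.p2) :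
    reachTime A x = 1 + x + 2 * A.d1 := by
  rw [reachTime, if_neg h.not_ge, if_pos h']

theorem reachTime_of_lt {A : Params} (hA : A.Admissible) {x : ℝ} (h : A.p2 < x) :
    reachTime A x = 1 + x + 2 * A.d1 + 2 * A.d2 := by
  rw [reachTime, if_neg (hA.p1_lt_p2.trans h).not_ge, if_neg h.not_ge]

theorem le_reachTime {A : Params} (hA : A.Admissible) (x : ℝ) : 1 + x ≤ reachTime A x := by
  have := hA.d1_pos
  have := hA.d2_pos
  unfold reachTime
  split_ifs <;> linarith

theorem reachTime_le {A : Params} (hA : A.Admissible) (x : ℝ) :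
    reachTime A x ≤ 1 + x + 2 * A.d1 + 2 * A.d2 := by
  have := hA.d1_pos
  have := hA.d2_pos
  unfold reachTime
  split_ifs <;> linarith

theorem reachTime_le_of_le_p2 {A : Params} (hA : A.Admissible) {x : ℝ} (h : x ≤ A.p2) :
    reachTime A x ≤ 1 + x + 2 * A.d1 := by
  have := hA.d1_pos
  unfold reachTime
  split_ifs <;> linarith

theorem track_reachTime {A : Params} (hA : A.Admissible) {x : ℝ} (h0 : 0 ≤ x) :
    track A (reachTime A x) = (Circle.exp x : ℂ) := by
  rcases le_or_gt x A.p1 with h1 | h1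
  · rw [reachTime_of_le h1, track_search0 h0 h1]
  rcases le_or_gt x A.p2 with h2 | h2
  · rw [reachTime_of_lt_of_le h1 h2, track_search1 hA h1.le h2]
  · rw [reachTime_of_lt hA h2, track_search2 hA h2.le]

/-- Before `reachTime A x` neither robot has been at the point with arc distance `x`; the height
`cos x` and the norm of a position suffice to tell. -/
theorem reachTime_le_of_track {A : Params} (hA : A.Admissible) {x t : ℝ} (hx : x ∈ Set.Icc 0 π)
    (ht : 0 ≤ t) (hn : ‖track A t‖ = 1) (hre : (track A t).re = cos x) : reachTime A x ≤ t := by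
  have i1 := hA.p1_pos
  have i2 := hA.d1_pos
  have i3 := hA.p1_lt_p2
  have i4 := hA.d2_pos
  have i5 := hA.p2_lt_pi
  have inj : ∀ b, 0 ≤ b → b ≤ π → track A t = (Circle.exp b : ℂ) → x = b := by
    intro b hb0 hb1 hb
    rw [hb, Circle.coe_exp, Complex.exp_ofReal_mul_I_re] at hre
    exact (injOn_cos ⟨hb0, hb1⟩ hx hre).symm
  rcases le_or_gt t 1 with h | h
  · have : track A t = (t : ℂ) := by rw [track, if_pos h]
    rw [this, Complex.norm_real, Real.norm_of_nonneg ht] at hn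
    subst hn
    rw [this, Complex.ofReal_re, ← cos_zero] at hre
    have : x = 0 := (injOn_cos ⟨le_rfl, pi_nonneg⟩ hx hre).symm
    rw [this, reachTime_of_le i1.le]
    linarith
  rcases le_or_gt t (1 + A.p1) with h1 | h1
  · obtain ⟨b, rfl⟩ : ∃ b, t = 1 + b := ⟨t - 1, by ring⟩
    obtain rfl := inj b (by linarith) (by linarith) (track_search0 (by linarith) (by linarith))
    exact (reachTime_of_le (by linarith)).le
  rcases le_or_gt t (1 + A.p1 + A.d1) with h2 | h2
  · obtain ⟨y, rfl⟩ : ∃ y, t = 1 + A.p1 + y := ⟨t - (1 + A.p1), by ring⟩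
    rw [track_cut1_out hA (by linarith) (by linarith)] at hn
    exact absurd hn (norm_cut_lt_one (by linarith) (by linarith [hA.d1_lt])).ne
  rcases lt_or_ge t (1 + A.p1 + 2 * A.d1) with h3 | h3
  · obtain ⟨y, rfl⟩ : ∃ y, t = 1 + A.p1 + 2 * A.d1 - y := ⟨1 + A.p1 + 2 * A.d1 - t, by ring⟩
    rw [track_cut1_back hA (by linarith) (by linarith)] at hn
    exact absurd hn (norm_cut_lt_one (by linarith) (by linarith [hA.d1_lt])).ne
  rcases le_or_gt t (1 + A.p2 + 2 * A.d1) with h4 | h4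
  · obtain ⟨b, rfl⟩ : ∃ b, t = 1 + b + 2 * A.d1 := ⟨t - 1 - 2 * A.d1, by ring⟩
    obtain rfl := inj b (by linarith) (by linarith)
      (track_search1 hA (by linarith) (by linarith))
    exact reachTime_le_of_le_p2 hA (by linarith)
  rcases le_or_gt t (1 + A.p2 + 2 * A.d1 + A.d2) with h5 | h5
  · obtain ⟨y, rfl⟩ : ∃ y, t = 1 + A.p2 + 2 * A.d1 + y := ⟨t - (1 + A.p2 + 2 * A.d1), by ring⟩
    rw [track_cut2_out hA (by linarith) (by linarith)] at hn
    exact absurd hn (norm_cut_lt_one (by linarith) (by linarith [hA.d2_lt])).ne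
  rcases lt_or_ge t (1 + A.p2 + 2 * A.d1 + 2 * A.d2) with h6 | h6
  · obtain ⟨y, rfl⟩ : ∃ y, t = 1 + A.p2 + 2 * A.d1 + 2 * A.d2 - y :=
      ⟨1 + A.p2 + 2 * A.d1 + 2 * A.d2 - t, by ring⟩
    rw [track_cut2_back hA (by linarith) (by linarith)] at hn
    exact absurd hn (norm_cut_lt_one (by linarith) (by linarith [hA.d2_lt])).ne
  obtain ⟨b, rfl⟩ : ∃ b, t = 1 + b + 2 * A.d1 + 2 * A.d2 := ⟨t - 1 - 2 * A.d1 - 2 * A.d2, by ring⟩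
  -- After time `1 + π + 2 * d1 + 2 * d2` the arc length is no longer determined by the position.
  rcases le_or_gt b π with h7 | h7
  · obtain rfl := inj b (by linarith) h7 (track_search2 hA (by linarith))
    exact reachTime_le hA x
  · exact (reachTime_le hA x).trans (by linarith [hx.2])

theorem pos_eq (A : Params) (I : Circle) (k : Robot) {t b : ℝ}
    (h : track A t = (Circle.exp b : ℂ)) : pos A I k t = (arcPoint I k b : ℂ) := by
  cases k
  · simp [pos, arcPoint, h]
  · rw [pos, arcPoint, h, Circle.coe_mul, Circle.exp_neg, Circle.coe_inv_eq_conj]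

theorem pos_re (A : Params) (I : Circle) (k : Robot) (t : ℝ) :
    ((I : ℂ)⁻¹ * pos A I k t).re = (track A t).re ∧ ‖pos A I k t‖ = ‖track A t‖ := by
  cases k <;> simp [pos, Circle.norm_coe]

theorem arcPoint_re (I : Circle) (k : Robot) (x : ℝ) :
    ((I : ℂ)⁻¹ * (arcPoint I k x : ℂ)).re = cos x := by
  cases k
  · simp [arcPoint, Complex.exp_ofReal_mul_I_re]
  · simp only [arcPoint, Circle.coe_mul, Circle.coe_exp, ne_eq, Circle.coe_ne_zero,
      not_false_eq_true, inv_mul_cancel_left₀, Complex.exp_ofReal_mul_I_re, cos_neg]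

theorem foundAt_boundary {A : Params} (hA : A.Admissible) (I : Circle) (k : Robot) {x : ℝ}
    (hx : x ∈ Set.Icc 0 π) : foundAt A I (.boundary (arcPoint I k x)) = reachTime A x := by
  refine IsLeast.csInf_eq ⟨⟨?_, k, pos_eq A I k (track_reachTime hA hx.1)⟩, ?_⟩
  · linarith [le_reachTime hA x, hx.1]
  · rintro t ⟨ht, j, hj⟩
    have h := pos_re A I j t
    rw [hj, arcPoint_re, Circle.norm_coe] at h
    exact reachTime_le_of_track hA hx ht h.2.symm h.1.symm

/-! ### The pickup delay -/

/-- Distance, at time `t`, of the partner from the point of the circle at arc distance `x` in the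
half searched by the robot itself. -/
def sep (A : Params) (x t : ℝ) : ℝ :=
  dist (Circle.exp x : ℂ) ((starRingEnd ℂ) (track A t))

/-- The pickup delay for an exit at arc distance `x` that is found at time `t₀`. -/
def delay (A : Params) (x t₀ : ℝ) : ℝ := sInf {t : ℝ | 0 ≤ t ∧ sep A x (t₀ + t) = t}

theorem dist_arcPoint_pos_other (A : Params) (I : Circle) (k : Robot) (x t : ℝ) :
    dist (arcPoint I k x : ℂ) (pos A I k.other t) = sep A x t := by
  have hI : ∀ z w : ℂ, dist ((I : ℂ) * z) ((I : ℂ) * w) = dist z w := by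
    intro z w
    rw [dist_eq_norm, ← mul_sub, norm_mul, Circle.norm_coe, one_mul, dist_eq_norm]
  cases k
  · simp only [arcPoint, Robot.other, pos, Circle.coe_mul, hI, sep]
  · simp only [arcPoint, Robot.other, pos, Circle.coe_mul, hI, sep, Circle.exp_neg,
      Circle.coe_inv_eq_conj]
    rw [← Complex.dist_conj_conj, Complex.conj_conj]

theorem pickupDelay_boundary {A : Params} (hA : A.Admissible) (I : Circle) (k : Robot) {x : ℝ}
    (hx : x ∈ Set.Icc 0 π) :
    pickupDelay A I (.boundary (arcPoint I k x)) = delay A x (reachTime A x) := by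
  -- If both robots find the exit at the same time, its two descriptions as a point of a half
  -- circle agree.
  have hf : arcPoint I (finder A I (.boundary (arcPoint I k x))) x = arcPoint I k x := by
    rw [finder, foundAt_boundary hA I k hx, pos_eq A I _ (track_reachTime hA hx.1)]
    split_ifs with h
    · exact Subtype.ext h
    · cases k
      · exact absurd rfl h
      · rfl
  unfold pickupDelay
  rw [foundAt_boundary hA I k hx]
  simp only [ExitPos.point]
  generalize finder A I (.boundary (arcPoint I k x)) = j at hf ⊢
  simp only [← hf, dist_arcPoint_pos_other, delay]

theorem pickupDelay_afterCut1 (A : Params) (I : Circle) (k : Robot) :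
    pickupDelay A I (.afterCut1 k) = delay A A.p1 (1 + A.p1 + 2 * A.d1) := by
  simp only [pickupDelay, ExitPos.point, finder, foundAt, dist_arcPoint_pos_other, delay]

theorem pickupDelay_afterCut2 (A : Params) (I : Circle) (k : Robot) :
    pickupDelay A I (.afterCut2 k) = delay A A.p2 (1 + A.p2 + 2 * A.d1 + 2 * A.d2) := by
  simp only [pickupDelay, ExitPos.point, finder, foundAt, dist_arcPoint_pos_other, delay]

theorem sep_nonneg (A : Params) (x t : ℝ) : 0 ≤ sep A x t := dist_nonneg

theorem abs_sep_sub_sep_le {A : Params} (hA : A.Admissible) (x x' t t' : ℝ) :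
    |sep A x t - sep A x' t'| ≤ |x - x'| + |t - t'| := by
  refine (dist_dist_dist_le _ _ _ _).trans (add_le_add (dist_exp_exp_le x x') ?_)
  rw [Complex.dist_conj_conj]
  simpa [Real.dist_eq] using (lipschitzWith_track hA).dist_le_mul t t'

theorem continuous_sep {A : Params} (hA : A.Admissible) (x : ℝ) : Continuous (sep A x) :=
  continuous_const.dist (Complex.continuous_conj.comp (lipschitzWith_track hA).continuous)

/-- A robot that is able to reach its partner by time `t₀ + t` meets it by that time. -/
theorem exists_meeting {A : Params} (hA : A.Admissible) {x t₀ t : ℝ} (ht : 0 ≤ t)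
    (h : sep A x (t₀ + t) ≤ t) : ∃ s ∈ Set.Icc 0 t, sep A x (t₀ + s) = s := by
  have hc : ContinuousOn (fun s => s - sep A x (t₀ + s)) (Set.Icc 0 t) :=
    (continuous_id.sub
      ((continuous_sep hA x).comp (continuous_const.add continuous_id))).continuousOn
  obtain ⟨s, hs, h0⟩ := intermediate_value_Icc ht hc
    (show (0 : ℝ) ∈ Set.Icc _ _ from ⟨by simpa using sep_nonneg A x _, by linarith⟩)
  exact ⟨s, hs, by linarith [show s - sep A x (t₀ + s) = 0 from h0]⟩

theorem bddBelow_meeting (A : Params) (x t₀ : ℝ) :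
    BddBelow {t : ℝ | 0 ≤ t ∧ sep A x (t₀ + t) = t} := ⟨0, fun _ h => h.1⟩

theorem delay_le {A : Params} (hA : A.Admissible) {x t₀ t : ℝ} (ht : 0 ≤ t)
    (h : sep A x (t₀ + t) ≤ t) : delay A x t₀ ≤ t := by
  obtain ⟨s, hs, h0⟩ := exists_meeting hA ht h
  exact (csInf_le (bddBelow_meeting A x t₀) ⟨hs.1, h0⟩).trans hs.2

theorem delay_lt {A : Params} (hA : A.Admissible) {x t₀ t : ℝ} (h : sep A x (t₀ + t) < t) :
    delay A x t₀ < t := by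
  obtain ⟨s, hs, h0⟩ := exists_meeting hA ((sep_nonneg A x _).trans h.le) h.le
  refine (csInf_le (bddBelow_meeting A x t₀) ⟨hs.1, h0⟩).trans_lt (hs.2.lt_of_ne ?_)
  rintro rfl
  exact h.ne h0

/-- The infimum in the definition of the delay is attained. -/
theorem delay_spec {A : Params} (hA : A.Admissible) (x : ℝ) {t₀ : ℝ} (h₀ : 0 ≤ t₀) :
    0 ≤ delay A x t₀ ∧ sep A x (t₀ + delay A x t₀) = delay A x t₀ := by
  have hclosed : IsClosed {t : ℝ | 0 ≤ t ∧ sep A x (t₀ + t) = t} :=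
    isClosed_Ici.inter (isClosed_eq
      ((continuous_sep hA x).comp (continuous_const.add continuous_id)) continuous_id)
  -- From some time on both points lie on the circle, at a distance of at most `2`.
  have hne : {t : ℝ | 0 ≤ t ∧ sep A x (t₀ + t) = t}.Nonempty := by
    have i1 := hA.p1_pos
    have i2 := hA.d1_pos
    have i3 := hA.p1_lt_p2
    have i4 := hA.d2_pos
    obtain ⟨s, hs, h0⟩ := exists_meeting hA (x := x) (t₀ := t₀)
      (t := 2 + (1 + A.p2 + 2 * A.d1 + 2 * A.d2)) (by linarith) (by
        rw [show t₀ + (2 + (1 + A.p2 + 2 * A.d1 + 2 * A.d2)) =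
          1 + (t₀ + 2 + A.p2) + 2 * A.d1 + 2 * A.d2 by ring, sep,
          track_search2 hA (by linarith), dist_exp_conj_exp]
        linarith [abs_sin_le_one ((x + (t₀ + 2 + A.p2)) / 2)])
    exact ⟨s, hs.1, h0⟩
  exact hclosed.csInf_mem hne (bddBelow_meeting A x t₀)

/-- As the partner has at most unit speed, a meeting is the first one as soon as the partner is
out of reach during a short time before it. -/
theorem delay_eq {A : Params} (hA : A.Admissible) {x t₀ r δ : ℝ} (hr : 0 ≤ r) (hδ : 0 < δ)
    (h : sep A x (t₀ + r) = r) (hlt : ∀ y, 0 < y → y ≤ δ → r - y < sep A x (t₀ + r - y)) :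
    delay A x t₀ = r := by
  refine IsLeast.csInf_eq ⟨⟨hr, h⟩, ?_⟩
  rintro t ⟨ht, hm⟩
  by_contra! htr
  rcases le_or_gt (r - t) δ with hy | hy
  · have := hlt (r - t) (by linarith) hy
    rw [show t₀ + r - (r - t) = t₀ + t by ring, hm] at this
    linarith
  · have h1 := hlt δ hδ le_rfl
    have h2 := (abs_le.1 (abs_sep_sub_sep_le hA x x (t₀ + r - δ) (t₀ + t))).2
    rw [sub_self, abs_zero, abs_of_pos (by linarith), hm] at h2
    linarith

/-! ### Distances along the trajectory -/

theorem sep_search0 {A : Params} (x : ℝ) {b : ℝ} (h0 : 0 ≤ b) (h1 : b ≤ A.p1) :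
    sep A x (1 + b) = 2 * |sin ((x + b) / 2)| := by
  rw [sep, track_search0 h0 h1, dist_exp_conj_exp]

theorem sep_search1 {A : Params} (hA : A.Admissible) (x : ℝ) {b : ℝ} (h0 : A.p1 ≤ b)
    (h1 : b ≤ A.p2) : sep A x (1 + b + 2 * A.d1) = 2 * |sin ((x + b) / 2)| := by
  rw [sep, track_search1 hA h0 h1, dist_exp_conj_exp]

theorem sep_search2 {A : Params} (hA : A.Admissible) (x : ℝ) {b : ℝ} (h0 : A.p2 ≤ b) :
    sep A x (1 + b + 2 * A.d1 + 2 * A.d2) = 2 * |sin ((x + b) / 2)| := by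
  rw [sep, track_search2 hA h0, dist_exp_conj_exp]

theorem sep_cut1_out_sq {A : Params} (hA : A.Admissible) (x : ℝ) {y : ℝ} (h0 : 0 ≤ y)
    (h1 : y ≤ A.d1) : sep A x (1 + A.p1 + y) ^ 2 =
      2 - 2 * cos (x + A.p1) - 2 * y * (sin (x + A.α1) + sin (A.p1 - A.α1)) + y ^ 2 := by
  rw [sep, track_cut1_out hA h0 h1, dist_exp_conj_cut_sq]

theorem sep_cut1_back_sq {A : Params} (hA : A.Admissible) (x : ℝ) {y : ℝ} (h0 : 0 ≤ y)
    (h1 : y ≤ A.d1) : sep A x (1 + A.p1 + 2 * A.d1 - y) ^ 2 =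
      2 - 2 * cos (x + A.p1) - 2 * y * (sin (x + A.α1) + sin (A.p1 - A.α1)) + y ^ 2 := by
  rw [sep, track_cut1_back hA h0 h1, dist_exp_conj_cut_sq]

theorem sep_cut2_out_sq {A : Params} (hA : A.Admissible) (x : ℝ) {y : ℝ} (h0 : 0 ≤ y)
    (h1 : y ≤ A.d2) : sep A x (1 + A.p2 + 2 * A.d1 + y) ^ 2 =
      2 - 2 * cos (x + A.p2) - 2 * y * (sin (x + A.α2) + sin (A.p2 - A.α2)) + y ^ 2 := by
  rw [sep, track_cut2_out hA h0 h1, dist_exp_conj_cut_sq]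

theorem sep_cut2_back_sq {A : Params} (hA : A.Admissible) (x : ℝ) {y : ℝ} (h0 : 0 ≤ y)
    (h1 : y ≤ A.d2) : sep A x (1 + A.p2 + 2 * A.d1 + 2 * A.d2 - y) ^ 2 =
      2 - 2 * cos (x + A.p2) - 2 * y * (sin (x + A.α2) + sin (A.p2 - A.α2)) + y ^ 2 := by
  rw [sep, track_cut2_back hA h0 h1, dist_exp_conj_cut_sq]

end

/-! ### Taylor bounds for sine and cosine -/

theorem le_of_hasDerivAt_le {f g f' g' : ℝ → ℝ} (hf : ∀ x, HasDerivAt f (f' x) x)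
    (hg : ∀ x, HasDerivAt g (g' x) x) (h0 : f 0 = g 0) (h : ∀ x, 0 ≤ x → f' x ≤ g' x) {x : ℝ}
    (hx : 0 ≤ x) : f x ≤ g x := by
  have hd : ∀ x, HasDerivAt (fun x => g x - f x) (g' x - f' x) x := fun x => (hg x).sub (hf x)
  have hm : MonotoneOn (fun x => g x - f x) (Set.Ici 0) := by
    refine monotoneOn_of_deriv_nonneg (convex_Ici 0)
      (fun x _ => (hd x).continuousAt.continuousWithinAt)
      (fun x _ => (hd x).differentiableAt.differentiableWithinAt) fun x hx => ?_
    rw [interior_Ici] at hx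
    rw [(hd x).deriv]
    exact sub_nonneg.2 (h x (le_of_lt hx))
  have := hm Set.self_mem_Ici hx hx
  simp only [h0, sub_self] at this
  linarith

theorem cos_le_taylor_four {x : ℝ} (hx : 0 ≤ x) : cos x ≤ 1 - x ^ 2 / 2 + x ^ 4 / 24 := by
  refine le_of_hasDerivAt_le (g := fun x => 1 - x ^ 2 / 2 + x ^ 4 / 24)
    (g' := fun x => -(x - x ^ 3 / 6)) hasDerivAt_cos (fun x => ?_) (by simp)
    (fun x hx => neg_le_neg (sin_ge_sub_cube hx)) hx
  refine ((((hasDerivAt_pow 2 x).div_const 2).const_sub 1).add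
    ((hasDerivAt_pow 4 x).div_const 24)).congr_deriv ?_
  push_cast
  ring

theorem sin_le_taylor_five {x : ℝ} (hx : 0 ≤ x) : sin x ≤ x - x ^ 3 / 6 + x ^ 5 / 120 := by
  refine le_of_hasDerivAt_le (g := fun x => x - x ^ 3 / 6 + x ^ 5 / 120)
    (g' := fun x => 1 - x ^ 2 / 2 + x ^ 4 / 24) hasDerivAt_sin (fun x => ?_) (by simp)
    (fun x hx => cos_le_taylor_four hx) hx
  refine (((hasDerivAt_id x).sub ((hasDerivAt_pow 3 x).div_const 6)).add
    ((hasDerivAt_pow 5 x).div_const 120)).congr_deriv ?_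
  push_cast
  ring

theorem taylor_six_le_cos {x : ℝ} (hx : 0 ≤ x) :
    1 - x ^ 2 / 2 + x ^ 4 / 24 - x ^ 6 / 720 ≤ cos x := by
  refine le_of_hasDerivAt_le (f := fun x => 1 - x ^ 2 / 2 + x ^ 4 / 24 - x ^ 6 / 720)
    (f' := fun x => -(x - x ^ 3 / 6 + x ^ 5 / 120)) (fun x => ?_) hasDerivAt_cos (by simp)
    (fun x hx => neg_le_neg (sin_le_taylor_five hx)) hx
  refine (((((hasDerivAt_pow 2 x).div_const 2).const_sub 1).add
    ((hasDerivAt_pow 4 x).div_const 24)).sub ((hasDerivAt_pow 6 x).div_const 720)).congr_deriv ?_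
  push_cast
  ring

theorem taylor_seven_le_sin {x : ℝ} (hx : 0 ≤ x) :
    x - x ^ 3 / 6 + x ^ 5 / 120 - x ^ 7 / 5040 ≤ sin x := by
  refine le_of_hasDerivAt_le (f := fun x => x - x ^ 3 / 6 + x ^ 5 / 120 - x ^ 7 / 5040)
    (f' := fun x => 1 - x ^ 2 / 2 + x ^ 4 / 24 - x ^ 6 / 720) (fun x => ?_) hasDerivAt_sin
    (by simp) (fun x hx => taylor_six_le_cos hx) hx
  refine ((((hasDerivAt_id x).sub ((hasDerivAt_pow 3 x).div_const 6)).add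
    ((hasDerivAt_pow 5 x).div_const 120)).sub ((hasDerivAt_pow 7 x).div_const 5040)).congr_deriv ?_
  push_cast
  ring

/-- Upper bound for `sin θ` from a bound on its supplementary angle. -/
theorem sin_le_of_pi_sub_le {θ b : ℝ} (h0 : 0 ≤ π - θ) (h : π - θ ≤ b) (hb : b ≤ 3 / 2) :
    sin θ ≤ b - b ^ 3 / 6 + b ^ 5 / 120 := by
  rw [← sin_pi_sub]
  exact (sin_le_sin_of_le_of_le_pi_div_two (by linarith [pi_pos]) (by linarith [pi_gt_three])
    h).trans (sin_le_taylor_five (h0.trans h))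

/-- Lower bound for `sin θ` from a bound on its supplementary angle. -/
theorem le_sin_of_le_pi_sub {θ a : ℝ} (h0 : 0 ≤ a) (h : a ≤ π - θ) (hb : π - θ ≤ 3 / 2) :
    a - a ^ 3 / 6 + a ^ 5 / 120 - a ^ 7 / 5040 ≤ sin θ := by
  rw [← sin_pi_sub θ]
  exact (taylor_seven_le_sin h0).trans (sin_le_sin_of_le_of_le_pi_div_two
    (by linarith [pi_pos]) (by linarith [pi_gt_three]) h)

/-! ### Inequalities behind the local comparisons -/

/-- The chord between two points of the circle that approach each other, and are far from opposite, gets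
shorter at almost the rate at which the arc does; a third of this rate is what is needed. -/
theorem sin_add_sub_sin_lt {θ v : ℝ} (h0 : 2.6 ≤ θ) (h1 : θ ≤ π) (hv : 0 < v) (hv' : v ≤ 1 / 2) :
    sin (θ + v) < sin θ - v / 3 := by
  have hs : 0 ≤ sin θ := sin_nonneg_of_nonneg_of_le_pi (by linarith) h1
  have hc : cos θ ≤ -0.85 := by
    have h := one_sub_sq_div_two_le_cos (x := π - θ)
    rw [cos_pi_sub] at h
    nlinarith [pi_lt_d4]
  have h3 : 0.9 * v ≤ sin v := by
    nlinarith [sin_ge_sub_cube hv.le, mul_nonneg hv.le (show 0 ≤ (1 / 2) ^ 2 - v ^ 2 by nlinarith)]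
  rw [sin_add]
  nlinarith [mul_le_mul_of_nonneg_left (cos_le_one v) hs,
    mul_le_mul_of_nonneg_right hc (show 0 ≤ sin v by linarith)]

/-- The chord between two points of the circle changes slowly while they are almost opposite to each
other. -/
theorem sin_sub_lt {θ v : ℝ} (h0 : π / 2 ≤ θ) (h1 : θ ≤ π / 2 + 0.1) (hv : 0 < v) :
    sin (θ - v) < sin θ + v / 3 := by
  have hs : 0 ≤ sin θ := sin_nonneg_of_nonneg_of_le_pi (by linarith [pi_pos])
    (by linarith [pi_gt_three])
  have hc : -cos θ ≤ 0.1 := by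
    rw [← sin_sub_pi_div_two]
    exact (sin_le (by linarith)).trans (by linarith)
  have hc' : 0 ≤ -cos θ := by
    rw [← sin_sub_pi_div_two]
    exact sin_nonneg_of_nonneg_of_le_pi (by linarith) (by linarith [pi_gt_three])
  rw [sin_sub]
  nlinarith [cos_le_one v, sin_le hv.le]

/-- Exits at arc distance `x + s` after `E₁`, with the partner on its way into the first cut: the
comparison of the squared distance with `(r - s / 2) ^ 2`, where `r = p - x` is the delay of `E₁`.
The term `0.1` is a margin. -/
theorem cut1_out_ineq {x p α s : ℝ} (hp : p = 2.62666582851) (hα : α = 2 * π / 9)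
    (hx0 : 0.6299 ≤ x) (hx1 : x ≤ 0.6301) (hs0 : 0 < s) (hs1 : s ≤ 0.981) :
    2 * cos (x + p) - 2 * cos (x + s + p) <
      s * (sin (x + s + α) + sin (p - α) - (p - x) - 0.1) := by
  have hpi := pi_gt_d6
  have hpi' := pi_lt_d6
  have hB : 1 - (x + s + α - π / 2) ^ 2 / 2 ≤ sin (x + s + α) := by
    rw [← cos_sub_pi_div_two]
    exact one_sub_sq_div_two_le_cos
  have hc : 0.935 ≤ sin (p - α) := by
    rw [← cos_sub_pi_div_two]
    refine le_trans ?_ one_sub_sq_div_two_le_cos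
    nlinarith
  have hu : 0.93 * (x + p - π + s / 2) ≤ sin (x + p - π + s / 2) := by
    have := sin_ge_sub_cube (x := x + p - π + s / 2) (by linarith)
    nlinarith [mul_nonneg (show 0 ≤ x + p - π + s / 2 by linarith)
      (show 0 ≤ 0.61 ^ 2 - (x + p - π + s / 2) ^ 2 by nlinarith)]
  have hs : 0.47 * s ≤ sin (s / 2) := by
    have := sin_ge_sub_cube (x := s / 2) (by linarith)
    nlinarith [mul_nonneg hs0.le (show 0 ≤ 1 - s ^ 2 by nlinarith)]
  have hcos : 2 * cos (x + p) - 2 * cos (x + s + p) =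
      -4 * (sin (x + p - π + s / 2) * sin (s / 2)) := by
    rw [← mul_sub, cos_sub_cos, show (x + p + (x + s + p)) / 2 = x + p - π + s / 2 + π by ring,
      show (x + p - (x + s + p)) / 2 = -(s / 2) by ring, sin_add_pi, sin_neg]
    ring
  have hprod : 0.93 * (0.114 + s / 2) * (0.47 * s) ≤ sin (x + p - π + s / 2) * sin (s / 2) :=
    mul_le_mul (by linarith) hs (by positivity) (by nlinarith)
  have hv : (x + s + α - π / 2) ^ 2 ≤ s ^ 2 - 0.48 * s + 0.06 := by
    have h1 : -0.243 ≤ x + α - π / 2 := by linarith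
    have h2 : x + α - π / 2 ≤ -0.242 := by linarith
    nlinarith
  rw [hcos]
  have : -4 * (0.93 * (0.114 + s / 2) * (0.47 * s)) <
      s * (1 - (s ^ 2 - 0.48 * s + 0.06) / 2 + 0.935 - 1.9968 - 0.1) := by
    nlinarith
  nlinarith

theorem le_sin_sub_of_add_sub_pi_le {x α s b : ℝ} (h0 : 0 ≤ x + α - π) (hb : x + α - π ≤ b)
    (hs : 0 < s) : s - b - s ^ 3 / 6 ≤ sin (x - s + α) := by
  rw [show x - s + α = π - (s - (x + α - π)) by ring, sin_pi_sub]
  rcases le_total 0 (s - (x + α - π)) with ht | ht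
  · have := sin_ge_sub_cube ht
    have := pow_le_pow_left₀ ht (show s - (x + α - π) ≤ s by linarith) 3
    linarith
  · linarith [le_sin ht, pow_pos hs 3]

/-- Exits at arc distance `x - s` before `E₂`, with the partner on its way back from the first cut:
the comparison of the squared distance with `(r + s / 2) ^ 2`, where `r = p + 2 * d - x` is the
delay of `E₂`. -/
theorem cut1_back_ineq {x p α d s : ℝ} (hp : p = 2.62666582851) (hα : α = 2 * π / 9)
    (hd : d = 0.490011696287)
    (hx0 : 2.5899 ≤ x) (hx1 : x ≤ 2.5901) (hs0 : 0 < s) (hs1 : s ≤ 2 * d) :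
    2 * cos (x + p) - 2 * cos (x - s + p) <
      s * (sin (x - s + α) + sin (p - α) + (p + 2 * d - x)) := by
  have hpi := pi_gt_d6
  have hpi' := pi_lt_d6
  have hc : 0.935 ≤ sin (p - α) := by
    rw [← cos_sub_pi_div_two]
    refine le_trans ?_ one_sub_sq_div_two_le_cos
    nlinarith
  have hcos : 2 * cos (x + p) - 2 * cos (x - s + p) =
      4 * (cos (x + p - s / 2 - 3 * π / 2) * sin (s / 2)) := by
    rw [← mul_sub, cos_sub_cos, show (x + p + (x - s + p)) / 2 =
      x + p - s / 2 - 3 * π / 2 + π / 2 + π by ring,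
      show (x + p - (x - s + p)) / 2 = s / 2 by ring, sin_add_pi, sin_add_pi_div_two]
    ring
  set z := x + p - s / 2 - 3 * π / 2 with hz
  have hz0 : 0 ≤ z := by linarith
  have hz1 : z ≤ 0.505 := by linarith
  have hcz : cos z ≤ 1 - z ^ 2 / 2 + z ^ 4 / 24 := cos_le_taylor_four hz0
  have hcz0 : 0 ≤ cos z := cos_nonneg_of_neg_pi_div_two_le_of_le (by linarith) (by linarith)
  have hw := le_sin_sub_of_add_sub_pi_le (x := x) (α := α) (s := s) (b := 0.1467) (by linarith)
    (by linarith) hs0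
  have hz2 : 0.254 - 0.5042 * s + s ^ 2 / 4 ≤ z ^ 2 := by
    nlinarith [show 0.504 - s / 2 ≤ z by linarith]
  have hz4 : z ^ 4 ≤ 0.2551 * z ^ 2 := by
    have : z ^ 2 ≤ 0.2551 := by nlinarith
    calc z ^ 4 = z ^ 2 * z ^ 2 := by ring
      _ ≤ 0.2551 * z ^ 2 := mul_le_mul_of_nonneg_right this (sq_nonneg z)
  have key : 2 * cos z < sin (x - s + α) + sin (p - α) + (p + 2 * d - x) := by
    nlinarith [mul_nonneg hs0.le (show 0 ≤ 1 - s ^ 2 by nlinarith)]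
  rw [hcos]
  nlinarith [mul_le_mul_of_nonneg_left (sin_le (show 0 ≤ s / 2 by linarith)) hcz0,
    mul_lt_mul_of_pos_left key hs0]

/-- Exits at arc distance `x - s` before `E₄`, with the partner on its way back from the second cut.
As in `cut1_back_ineq`, `r = p + 2 * d - x` is the delay of `E₄`; after division by `s` both
sides are within one percent of each other for small `s`, hence the fifth-order bound for `sin y`. -/
theorem cut2_back_ineq {x p α d s : ℝ} (hp : p = 2.97374843355) (hα : α = 0.05523991 * π)
    (hd : d = 0.1670474016)
    (hx0 : 2.9722 ≤ x) (hx1 : x ≤ 2.9725) (hs0 : 0 < s) (hs1 : s ≤ 2 * d) :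
    2 * cos (x + p) - 2 * cos (x - s + p) <
      s * (sin (x - s + α) + sin (p - α) + (p + 2 * d - x)) := by
  have hpi := pi_gt_d6
  have hpi' := pi_lt_d6
  have hc : 0.33478 ≤ sin (p - α) := by
    refine le_trans ?_ (le_sin_of_le_pi_sub (a := 0.34138) (by norm_num) (by linarith)
      (by linarith))
    norm_num
  have hcos : 2 * cos (x + p) - 2 * cos (x - s + p) =
      4 * (sin (2 * π - x - p + s / 2) * sin (s / 2)) := by
    rw [← mul_sub, cos_sub_cos, show (x + p + (x - s + p)) / 2 =
      2 * π - (2 * π - x - p + s / 2) by ring,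
      show (x + p - (x - s + p)) / 2 = s / 2 by ring, sin_two_pi_sub]
    ring
  set y := 2 * π - x - p + s / 2 with hy
  have hy0 : 0.3369 + s / 2 ≤ y := by linarith
  have hy1 : y ≤ 0.33724 + s / 2 := by linarith
  have hsy : sin y ≤ y - y ^ 3 / 6 + y ^ 5 / 120 := sin_le_taylor_five (by linarith)
  have hsy0 : 0 ≤ sin y := sin_nonneg_of_nonneg_of_le_pi (by linarith) (by linarith)
  have hw := le_sin_sub_of_add_sub_pi_le (x := x) (α := α) (s := s) (b := 0.00445) (by linarith)
    (by linarith) hs0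
  have hy3 : 0.038 + 0.17 * s ≤ y ^ 3 := by
    have : (0.3369 + s / 2) ^ 3 ≤ y ^ 3 := pow_le_pow_left₀ (by linarith) hy0 3
    linarith [pow_pos hs0 3, pow_pos hs0 2,
      show (0.3369 + s / 2) ^ 3 = 0.3369 ^ 3 + 3 / 2 * 0.3369 ^ 2 * s + 3 / 4 * 0.3369 * s ^ 2 +
        s ^ 3 / 8 by ring]
  have hy5 : y ^ 5 ≤ 0.26 * y ^ 3 := by
    have : y ^ 2 ≤ 0.26 := (pow_le_pow_left₀ (by linarith) (show y ≤ 0.505 by linarith) 2).trans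
      (by norm_num)
    calc y ^ 5 = y ^ 2 * y ^ 3 := by ring
      _ ≤ 0.26 * y ^ 3 := mul_le_mul_of_nonneg_right this (by linarith)
  have hs3 : s ^ 3 ≤ 0.112 * s := by
    have : s ^ 2 ≤ 0.112 := by nlinarith
    calc s ^ 3 = s ^ 2 * s := by ring
      _ ≤ 0.112 * s := mul_le_mul_of_nonneg_right this hs0.le
  have key : 2 * sin y < sin (x - s + α) + sin (p - α) + (p + 2 * d - x) := by
    linarith
  rw [hcos]
  nlinarith [mul_le_mul_of_nonneg_left (sin_le (show 0 ≤ s / 2 by linarith)) hsy0,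
    mul_lt_mul_of_pos_left key hs0]

/-- Exits at arc distance `s` behind the first cut of the finder, with the partner on its way into
the second cut: the comparison of the squared distance with `(r - s / 2) ^ 2`, where
`r = p' - p + q` is the delay for the exit found immediately after the first cut. The term `0.7` is a margin. -/
theorem cut2_out_ineq {p p' α q s : ℝ} (hp : p = 2.62666582851) (hp' : p' = 2.97374843355)
    (hα : α = 0.05523991 * π) (hq0 : 0.1609 ≤ q) (hq1 : q ≤ 0.1616) (hs0 : 0 < s)
    (hs1 : s ≤ 0.0125) :
    2 * cos (p + p') - 2 * cos (p + s + p') - 2 * q * (sin (p + s + α) - sin (p + α)) <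
      s * (sin (p + s + α) + sin (p' - α) - q - (p' - p + q) - 0.7) := by
  have hpi := pi_gt_d6
  have hpi' := pi_lt_d6
  have hc : 0.33 ≤ sin (p' - α) := by
    refine le_trans ?_ (le_sin_of_le_pi_sub (a := 0.3413) (by norm_num) (by linarith)
      (by linarith))
    norm_num
  have hb : 0.32 ≤ sin (p + s + α) := by
    refine le_trans ?_ (le_sin_of_le_pi_sub (a := 0.3285) (by norm_num) (by linarith)
      (by linarith))
    norm_num
  have hd := (abs_le.1 (abs_sin_sub_sin_le (p + s + α) (p + α))).1
  rw [show p + s + α - (p + α) = s by ring, abs_of_pos hs0] at hd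
  have hcos : 2 * cos (p + p') - 2 * cos (p + s + p') =
      -4 * (sin (2 * π - p - p' - s / 2) * sin (s / 2)) := by
    rw [← mul_sub, cos_sub_cos, show (p + p' + (p + s + p')) / 2 =
      2 * π - (2 * π - p - p' - s / 2) by ring,
      show (p + p' - (p + s + p')) / 2 = -(s / 2) by ring, sin_two_pi_sub, sin_neg]
    ring
  have hsy : 0.6 ≤ sin (2 * π - p - p' - s / 2) := by
    have h1 : 0.675 ≤ 2 * π - p - p' - s / 2 := by linarith
    refine le_trans ?_ ((taylor_seven_le_sin (x := 0.675) (by norm_num)).trans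
      (sin_le_sin_of_le_of_le_pi_div_two (by linarith) (by linarith) h1))
    norm_num
  have hs : 0.49 * s ≤ sin (s / 2) := by
    have := sin_ge_sub_cube (x := s / 2) (by linarith)
    nlinarith [mul_nonneg hs0.le (show 0 ≤ 0.1 - s ^ 2 by nlinarith)]
  have hprod : 0.6 * (0.49 * s) ≤ sin (2 * π - p - p' - s / 2) * sin (s / 2) :=
    mul_le_mul hsy hs (by positivity) (by linarith)
  rw [hcos]
  nlinarith [mul_le_mul_of_nonneg_left hd (show 0 ≤ 2 * q by linarith)]

/-- The depth `q` in the second cut of the partner at which it is picked up if the exit is found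
immediately after the first cut. -/
theorem exists_depth {p p' α : ℝ} (hp : p = 2.62666582851) (hp' : p' = 2.97374843355)
    (hα : α = 0.05523991 * π) : ∃ q, 0.1609 ≤ q ∧ q ≤ 0.1616 ∧
      2 - 2 * cos (p + p') - 2 * q * (sin (p + α) + sin (p' - α)) + q ^ 2 = (p' - p + q) ^ 2 := by
  have hpi := pi_gt_d6
  have hpi' := pi_lt_d6
  have hc : 0.3347 ≤ sin (p' - α) := by
    refine le_trans ?_ (le_sin_of_le_pi_sub (a := 0.34138) (by norm_num) (by linarith)
      (by linarith))
    norm_num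
  have hc' : sin (p' - α) ≤ 0.3349 := by
    refine (sin_le_of_pi_sub_le (b := 0.34139) (by linarith) (by linarith)
      (by norm_num)).trans ?_
    norm_num
  have hb : 0.3347 ≤ sin (p + α) := by
    refine le_trans ?_ (le_sin_of_le_pi_sub (a := 0.34138) (by norm_num) (by linarith)
      (by linarith))
    norm_num
  have hb' : sin (p + α) ≤ 0.3349 := by
    refine (sin_le_of_pi_sub_le (b := 0.34139) (by linarith) (by linarith)
      (by norm_num)).trans ?_
    norm_num
  have hcos : cos (p + p') = cos (2 * π - p - p') := by
    rw [show p + p' = 2 * π - (2 * π - p - p') by ring, cos_two_pi_sub]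
  have h1 : 0.6827 ≤ 2 * π - p - p' := by linarith
  have h2 : 2 * π - p - p' ≤ 0.6828 := by linarith
  have hle : cos (p + p') ≤ 0.7761 := by
    rw [hcos]
    refine (cos_le_cos_of_nonneg_of_le_pi (by norm_num) (by linarith) h1).trans
      ((cos_le_taylor_four (by norm_num)).trans ?_)
    norm_num
  have hge : 0.7757 ≤ cos (p + p') := by
    rw [hcos]
    refine le_trans ?_ ((taylor_six_le_cos (x := 0.6828) (by norm_num)).trans
      (cos_le_cos_of_nonneg_of_le_pi (by linarith) (by linarith) h2))
    norm_num
  have hpos : 0 < 2 * (p' - p + (sin (p + α) + sin (p' - α))) := by linarith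
  refine ⟨(2 - 2 * cos (p + p') - (p' - p) ^ 2) /
    (2 * (p' - p + (sin (p + α) + sin (p' - α)))), ?_, ?_, ?_⟩
  · rw [le_div_iff₀ hpos, hp, hp'] at *
    norm_num at *
    linarith
  · rw [div_le_iff₀ hpos, hp, hp'] at *
    norm_num at *
    linarith
  · generalize hS : sin (p + α) + sin (p' - α) = S at *
    have hne : p' - p + S ≠ 0 := by linarith
    field_simp
    ring

/-! ### The exits for which the partner is picked up at the start point of its cuts -/

theorem abs_sin_sub_sin_lt {a b : ℝ} (h : a ≠ b) : |sin a - sin b| < |a - b| := by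
  have h0 : (a - b) / 2 ≠ 0 := div_ne_zero (sub_ne_zero.2 h) two_ne_zero
  have h1 := abs_sin_lt_abs h0
  rw [abs_div, abs_two] at h1
  rw [sin_sub_sin, abs_mul, abs_mul, abs_two]
  nlinarith [abs_cos_le_one ((a + b) / 2), abs_nonneg (sin ((a - b) / 2))]

/-- Moving along the circle changes the distance to a fixed point at less than unit speed. -/
theorem two_mul_abs_sin_sub_lt (x b : ℝ) {y : ℝ} (hy : 0 < y) :
    2 * |sin ((x + b) / 2)| - y < 2 * |sin ((x + (b - y)) / 2)| := by
  have h := abs_sin_sub_sin_lt (a := (x + b) / 2) (b := (x + (b - y)) / 2) (by linarith)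
  rw [show (x + b) / 2 - (x + (b - y)) / 2 = y / 2 by ring, abs_of_pos (half_pos hy)] at h
  linarith [abs_sub_abs_le_abs_sub (sin ((x + b) / 2)) (sin ((x + (b - y)) / 2))]

theorem strictMono_add_two_mul_sin (p : ℝ) : StrictMono fun x => x + 2 * sin ((x + p) / 2) := by
  intro a b hab
  have h := abs_sin_sub_sin_lt (a := (a + p) / 2) (b := (b + p) / 2) (by linarith)
  rw [show (a + p) / 2 - (b + p) / 2 = -((b - a) / 2) by ring, abs_neg,
    abs_of_pos (show 0 < (b - a) / 2 by linarith)] at h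
  simp only
  linarith [(abs_lt.1 h).2]

theorem exists_add_two_mul_sin_eq {p c lo hi : ℝ} (h : lo ≤ hi)
    (hlo : lo + 2 * sin ((lo + p) / 2) ≤ c) (hhi : c ≤ hi + 2 * sin ((hi + p) / 2)) :
    ∃ x, lo ≤ x ∧ x ≤ hi ∧ x + 2 * sin ((x + p) / 2) = c := by
  have hc : ContinuousOn (fun x => x + 2 * sin ((x + p) / 2)) (Set.Icc lo hi) := by fun_prop
  obtain ⟨x, hx, hxc⟩ := intermediate_value_Icc h hc ⟨hlo, hhi⟩
  exact ⟨x, hx.1, hx.2, hxc⟩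

theorem exists_x1 {p : ℝ} (hp : p = 2.62666582851) :
    ∃ x, 0.6299 ≤ x ∧ x ≤ 0.6301 ∧ x + 2 * sin ((x + p) / 2) = p := by
  have hpi := pi_gt_d6
  have hpi' := pi_lt_d6
  refine exists_add_two_mul_sin_eq (by norm_num) ?_ ?_
  · rw [← cos_sub_pi_div_two]
    have h1 : 0.0574 ≤ (0.6299 + p) / 2 - π / 2 := by linarith
    have := (cos_le_cos_of_nonneg_of_le_pi (by norm_num) (by linarith) h1).trans
      (cos_le_taylor_four (by norm_num))
    norm_num at this ⊢
    linarith
  · rw [← cos_sub_pi_div_two]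
    have h1 : (0.6301 + p) / 2 - π / 2 ≤ 0.0576 := by linarith
    have := (one_sub_sq_div_two_le_cos (x := 0.0576)).trans
      (cos_le_cos_of_nonneg_of_le_pi (by linarith) (by linarith) h1)
    norm_num at this ⊢
    linarith

theorem exists_x2 {p d : ℝ} (hp : p = 2.62666582851) (hd : d = 0.490011696287) :
    ∃ x, 2.5899 ≤ x ∧ x ≤ 2.5901 ∧ x + 2 * sin ((x + p) / 2) = p + 2 * d := by
  have hpi := pi_gt_d6
  have hpi' := pi_lt_d6
  refine exists_add_two_mul_sin_eq (by norm_num) ?_ ?_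
  · have := sin_le_of_pi_sub_le (θ := (2.5899 + p) / 2) (b := 0.533311) (by linarith) (by linarith)
      (by norm_num)
    norm_num at this ⊢
    linarith
  · have := le_sin_of_le_pi_sub (θ := (2.5901 + p) / 2) (a := 0.533209) (by norm_num) (by linarith)
      (by linarith)
    norm_num at this ⊢
    linarith

theorem exists_x4 {p d : ℝ} (hp : p = 2.97374843355) (hd : d = 0.1670474016) :
    ∃ x, 2.9722 ≤ x ∧ x ≤ 2.9725 ∧ x + 2 * sin ((x + p) / 2) = p + 2 * d := by
  have hpi := pi_gt_d20
  have hpi' := pi_lt_d20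
  refine exists_add_two_mul_sin_eq (by norm_num) ?_ ?_
  · have := sin_le_of_pi_sub_le (θ := (2.9722 + p) / 2) (b := 0.168619) (by linarith)
      (by linarith) (by norm_num)
    norm_num at this ⊢
    linarith
  · have := le_sin_of_le_pi_sub (θ := (2.9725 + p) / 2) (a := 0.1684684) (by norm_num)
      (by linarith) (by linarith)
    norm_num at this ⊢
    linarith

/-! ### Evacuation times near the five candidates -/

theorem p1_eq {A : Params} (hA : A = Params.star) : A.p1 = 2.62666582851 := by rw [hA]; rfl
theorem α1_eq {A : Params} (hA : A = Params.star) : A.α1 = 2 * π / 9 := by rw [hA]; rfl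
theorem d1_eq {A : Params} (hA : A = Params.star) : A.d1 = 0.490011696287 := by rw [hA]; rfl
theorem p2_eq {A : Params} (hA : A = Params.star) : A.p2 = 2.97374843355 := by rw [hA]; rfl
theorem α2_eq {A : Params} (hA : A = Params.star) : A.α2 = 0.05523991 * π := by rw [hA]; rfl
theorem d2_eq {A : Params} (hA : A = Params.star) : A.d2 = 0.1670474016 := by rw [hA]; rfl

theorem admissible {A : Params} (hA : A = Params.star) : A.Admissible := by
  have hpi := pi_gt_d6
  have hpi' := pi_lt_d6
  refine ⟨?_, ?_, ?_, ?_, ?_, ?_, ?_⟩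
  · norm_num [p1_eq hA]
  · norm_num [d1_eq hA]
  · norm_num [p1_eq hA, p2_eq hA]
  · rw [p2_eq hA]
    linarith
  · norm_num [d2_eq hA]
  · have := le_sin_of_le_pi_sub (θ := A.p1 - A.α1) (a := 1) zero_le_one
      (by rw [p1_eq hA, α1_eq hA]; linarith) (by rw [p1_eq hA, α1_eq hA]; linarith)
    rw [d1_eq hA]
    norm_num at this ⊢
    linarith
  · have := le_sin_of_le_pi_sub (θ := A.p2 - A.α2) (a := 0.3) (by norm_num)
      (by rw [p2_eq hA, α2_eq hA]; linarith) (by rw [p2_eq hA, α2_eq hA]; linarith)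
    rw [d2_eq hA]
    norm_num at this ⊢
    linarith

/-- If the partner can be reached within a time `t` with `t₀ + 2 * t = V`, with some time to spare,
then the evacuation is completed before time `V`. -/
theorem add_two_mul_delay_lt {A : Params} (hA : A.Admissible) {x t₀ t T V : ℝ} (hT : t₀ + t = T)
    (hV : t₀ + 2 * t = V) (h : sep A x T < t) : t₀ + 2 * delay A x t₀ < V := by
  subst hT hV
  linarith [delay_lt hA h]

section

variable {A : Params} {x x₁ x₂ x₄ q : ℝ}

theorem two_mul_abs_sin_of_eq {x p c : ℝ} (h0 : 0 ≤ x + p) (h1 : x + p ≤ 2 * π)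
    (h : x + 2 * sin ((x + p) / 2) = c) : 2 * |sin ((x + p) / 2)| = c - x := by
  rw [abs_of_nonneg (sin_nonneg_of_nonneg_of_le_pi (by linarith) (by linarith))]
  linarith

theorem delay_x1 (hA : A.Admissible) (h0 : 0 ≤ x₁) (h1 : x₁ < A.p1)
    (h : x₁ + 2 * sin ((x₁ + A.p1) / 2) = A.p1) :
    delay A x₁ (reachTime A x₁) = A.p1 - x₁ := by
  have hp := hA.p1_pos
  have hs := two_mul_abs_sin_of_eq (by linarith)
    (by linarith [hA.p1_lt_p2, hA.p2_lt_pi]) h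
  rw [reachTime_of_le h1.le]
  refine delay_eq hA (δ := A.p1) (by linarith) hp ?_ fun y hy0 hy1 => ?_
  · rw [show 1 + x₁ + (A.p1 - x₁) = 1 + A.p1 by ring, sep_search0 _ hp.le le_rfl, hs]
  · rw [show 1 + x₁ + (A.p1 - x₁) - y = 1 + (A.p1 - y) by ring,
      sep_search0 _ (by linarith) (by linarith)]
    linarith [two_mul_abs_sin_sub_lt x₁ A.p1 hy0]

/-- By `hdir` the partner does not escape straight away from the exit at the end of its cut, which
would make it reachable earlier. -/
theorem delay_x2 (hA : A.Admissible) (h0 : 0 ≤ x₂) (h1 : x₂ ≤ A.p1)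
    (h : x₂ + 2 * sin ((x₂ + A.p1) / 2) = A.p1 + 2 * A.d1)
    (hdir : sin (x₂ + A.α1) + sin (A.p1 - A.α1) < A.p1 + 2 * A.d1 - x₂) :
    delay A x₂ (reachTime A x₂) = A.p1 + 2 * A.d1 - x₂ := by
  have hd := hA.d1_pos
  have hs : sep A x₂ (1 + A.p1 + 2 * A.d1) = A.p1 + 2 * A.d1 - x₂ := by
    rw [sep_search1 hA _ le_rfl hA.p1_lt_p2.le, two_mul_abs_sin_of_eq (by linarith [hA.p1_pos])
      (by linarith [hA.p1_lt_p2, hA.p2_lt_pi]) h]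
  rw [reachTime_of_le h1]
  refine delay_eq hA (δ := A.d1) (by linarith) hd ?_ fun y hy0 hy1 => ?_
  · rw [show 1 + x₂ + (A.p1 + 2 * A.d1 - x₂) = 1 + A.p1 + 2 * A.d1 by ring, hs]
  · rw [show 1 + x₂ + (A.p1 + 2 * A.d1 - x₂) - y = 1 + A.p1 + 2 * A.d1 - y by ring]
    have e0 := sep_cut1_back_sq hA x₂ le_rfl hd.le
    have e1 := sep_cut1_back_sq hA x₂ hy0.le hy1
    rw [sub_zero, hs] at e0
    refine lt_of_pow_lt_pow_left₀ 2 (sep_nonneg _ _ _) ?_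
    nlinarith [mul_lt_mul_of_pos_left hdir hy0]

/-- As for `delay_x2`, the partner does not move straight away from the exit at the end of its cut.
-/
theorem delay_x4 (hA : A.Admissible) (h0 : A.p1 < x₄) (h1 : x₄ ≤ A.p2)
    (h : x₄ + 2 * sin ((x₄ + A.p2) / 2) = A.p2 + 2 * A.d2)
    (hdir : sin (x₄ + A.α2) + sin (A.p2 - A.α2) < A.p2 + 2 * A.d2 - x₄) :
    delay A x₄ (reachTime A x₄) = A.p2 + 2 * A.d2 - x₄ := by
  have hp := hA.p1_pos
  have hd := hA.d2_pos
  have hs : sep A x₄ (1 + A.p2 + 2 * A.d1 + 2 * A.d2) = A.p2 + 2 * A.d2 - x₄ := by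
    rw [sep_search2 hA _ le_rfl, two_mul_abs_sin_of_eq (by linarith)
      (by linarith [hA.p2_lt_pi]) h]
  rw [reachTime_of_lt_of_le h0 h1]
  refine delay_eq hA (δ := A.d2) (by linarith) hd ?_ fun y hy0 hy1 => ?_
  · rw [show 1 + x₄ + 2 * A.d1 + (A.p2 + 2 * A.d2 - x₄) = 1 + A.p2 + 2 * A.d1 + 2 * A.d2 by ring,
      hs]
  · rw [show 1 + x₄ + 2 * A.d1 + (A.p2 + 2 * A.d2 - x₄) - y =
      1 + A.p2 + 2 * A.d1 + 2 * A.d2 - y by ring]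
    have e0 := sep_cut2_back_sq hA x₄ le_rfl hd.le
    have e1 := sep_cut2_back_sq hA x₄ hy0.le hy1
    rw [sub_zero, hs] at e0
    refine lt_of_pow_lt_pow_left₀ 2 (sep_nonneg _ _ _) ?_
    nlinarith [mul_lt_mul_of_pos_left hdir hy0]

/-- The hypothesis `hq` says that the partner, at depth `q` in its second cut, has the distance from
the exit that the finder can cover in the meantime. -/
theorem delay_afterCut1 (hA : A.Admissible) (hq0 : 0 < q) (hq1 : q ≤ A.d2)
    (hq : 2 - 2 * cos (A.p1 + A.p2) - 2 * q * (sin (A.p1 + A.α2) + sin (A.p2 - A.α2)) + q ^ 2 =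
      (A.p2 - A.p1 + q) ^ 2)
    (hdir : 0 ≤ sin (A.p1 + A.α2) + sin (A.p2 - A.α2)) :
    delay A A.p1 (1 + A.p1 + 2 * A.d1) = A.p2 - A.p1 + q := by
  have hp := hA.p1_lt_p2
  refine delay_eq hA (δ := q) (by linarith) hq0 ?_ fun y hy0 hy1 => ?_
  · rw [show 1 + A.p1 + 2 * A.d1 + (A.p2 - A.p1 + q) = 1 + A.p2 + 2 * A.d1 + q by ring]
    rw [← sq_eq_sq₀ (sep_nonneg _ _ _) (by linarith), sep_cut2_out_sq hA _ hq0.le hq1, hq]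
  · rw [show 1 + A.p1 + 2 * A.d1 + (A.p2 - A.p1 + q) - y = 1 + A.p2 + 2 * A.d1 + (q - y) by ring]
    refine lt_of_pow_lt_pow_left₀ 2 (sep_nonneg _ _ _) ?_
    rw [sep_cut2_out_sq hA _ (by linarith) (by linarith)]
    nlinarith [mul_pos hy0 (show 0 < A.p2 - A.p1 by linarith), mul_nonneg hy0.le hdir]

/-- Exits before `E₁`: the partner is picked up during its search before the first cut. -/
theorem evac_lt_of_lt_x1 (hA : A = Params.star) (hx1 : 0.6299 ≤ x₁) (hx1' : x₁ ≤ 0.6301)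
    (h : x₁ + 2 * sin ((x₁ + A.p1) / 2) = A.p1) (h0 : 0 ≤ x) (hx : x < x₁) :
    reachTime A x + 2 * delay A x (reachTime A x) < 1 + 2 * A.p1 - x₁ := by
  have hpi := pi_gt_d6
  have hpi' := pi_lt_d6
  have hp := p1_eq hA
  rw [reachTime_of_le (by linarith)]
  refine add_two_mul_delay_lt (admissible hA) (t := A.p1 - x₁ + (x₁ - x) / 2)
    (T := 1 + (A.p1 - (x₁ - x) / 2)) (by ring) (by ring) ?_
  rw [sep_search0 _ (by linarith) (by linarith), abs_of_nonneg
    (sin_nonneg_of_nonneg_of_le_pi (by linarith) (by linarith)),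
    show (x + (A.p1 - (x₁ - x) / 2)) / 2 = (x₁ + A.p1) / 2 - 3 / 4 * (x₁ - x) by ring]
  linarith [sin_sub_lt (θ := (x₁ + A.p1) / 2) (v := 3 / 4 * (x₁ - x)) (by linarith) (by linarith)
    (by linarith)]

/-- Exits after `E₁`: the partner is picked up on its way into the first cut. -/
theorem evac_lt_of_x1_lt (hA : A = Params.star) (hx1 : 0.6299 ≤ x₁) (hx1' : x₁ ≤ 0.6301)
    (h : x₁ + 2 * sin ((x₁ + A.p1) / 2) = A.p1) (hx : x₁ < x) (hx' : x ≤ x₁ + 2 * A.d1 + 0.015) :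
    reachTime A x + 2 * delay A x (reachTime A x) < 1 + 2 * A.p1 - x₁ := by
  have hA' := admissible hA
  have hp := p1_eq hA
  have hd := d1_eq hA
  have hs := two_mul_abs_sin_of_eq (by linarith) (by linarith [pi_gt_three]) h
  have e0 := sep_cut1_out_sq hA' x₁ le_rfl hA'.d1_pos.le
  rw [add_zero, sep_search0 _ hA'.p1_pos.le le_rfl, hs] at e0
  have key : ∀ s, 0 < s → s ≤ 2 * A.d1 →
      sep A (x₁ + s) (1 + A.p1 + s / 2) ^ 2 < (A.p1 - x₁ - s / 2) ^ 2 - 0.1 * s := by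
    intro s hs0 hs1
    rw [sep_cut1_out_sq hA' _ (by linarith) (by linarith)]
    linarith [cut1_out_ineq hp (α1_eq hA) hx1 hx1' hs0 (by linarith)]
  rw [reachTime_of_le (by linarith)]
  refine add_two_mul_delay_lt hA' (t := A.p1 - x₁ - (x - x₁) / 2)
    (T := 1 + A.p1 + (x - x₁) / 2) (by ring) (by ring) ?_
  rcases le_or_gt (x - x₁) (2 * A.d1) with h2 | h2
  · have := key (x - x₁) (by linarith) h2
    rw [add_sub_cancel] at this
    exact lt_of_pow_lt_pow_left₀ 2 (by linarith) (by linarith)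
  · -- A margin at the turning point of the partner covers the exits shortly after it.
    have h3 : sep A (x₁ + 2 * A.d1) (1 + A.p1 + A.d1) < A.p1 - x₁ - A.d1 - 0.03 := by
      refine lt_of_pow_lt_pow_left₀ 2 (by linarith) ?_
      have := key (2 * A.d1) (by linarith) le_rfl
      rw [mul_div_cancel_left₀ _ (two_ne_zero' ℝ)] at this
      nlinarith
    have h4 := (abs_le.1 (abs_sep_sub_sep_le hA' x (x₁ + 2 * A.d1)
      (1 + A.p1 + (x - x₁) / 2) (1 + A.p1 + A.d1))).2
    rw [abs_of_pos (by linarith), abs_of_pos (by linarith)] at h4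
    linarith

/-- Exits before `E₂`: the partner is picked up on its way back from the first cut. -/
theorem evac_lt_of_lt_x2 (hA : A = Params.star) (hx2 : 2.5899 ≤ x₂) (hx2' : x₂ ≤ 2.5901)
    (h : x₂ + 2 * sin ((x₂ + A.p1) / 2) = A.p1 + 2 * A.d1) (h0 : x₂ - 2 * A.d1 ≤ x)
    (hx : x < x₂) :
    reachTime A x + 2 * delay A x (reachTime A x) < 1 + 2 * A.p1 + 4 * A.d1 - x₂ := by
  have hA' := admissible hA
  have hp := p1_eq hA
  have hd := d1_eq hA
  have hs := two_mul_abs_sin_of_eq (by linarith) (by linarith [pi_gt_three]) h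
  have e0 := sep_cut1_back_sq hA' x₂ le_rfl hA'.d1_pos.le
  rw [sub_zero, sep_search1 hA' _ le_rfl hA'.p1_lt_p2.le, hs] at e0
  rw [reachTime_of_le (by linarith)]
  refine add_two_mul_delay_lt hA' (t := A.p1 + 2 * A.d1 - x₂ + (x₂ - x) / 2)
    (T := 1 + A.p1 + 2 * A.d1 - (x₂ - x) / 2) (by ring) (by ring) ?_
  refine lt_of_pow_lt_pow_left₀ 2 (by linarith) ?_
  rw [sep_cut1_back_sq hA' _ (by linarith) (by linarith)]
  have := cut1_back_ineq hp (α1_eq hA) hd hx2 hx2' (s := x₂ - x) (by linarith) (by linarith)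
  rw [sub_sub_cancel] at this
  linarith

/-- Exits after `E₂`: the partner is picked up during its search after the first cut. -/
theorem evac_lt_of_x2_lt (hA : A = Params.star) (hx2 : 2.5899 ≤ x₂)
    (h : x₂ + 2 * sin ((x₂ + A.p1) / 2) = A.p1 + 2 * A.d1) (hx : x₂ < x) (hx' : x ≤ A.p1) :
    reachTime A x + 2 * delay A x (reachTime A x) < 1 + 2 * A.p1 + 4 * A.d1 - x₂ := by
  have hpi := pi_gt_d6
  have hp := p1_eq hA
  have hp2 := p2_eq hA
  have hd := d1_eq hA
  rw [reachTime_of_le hx']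
  refine add_two_mul_delay_lt (admissible hA) (t := A.p1 + 2 * A.d1 - x₂ - (x - x₂) / 2)
    (T := 1 + (A.p1 + (x - x₂) / 2) + 2 * A.d1) (by ring) (by ring) ?_
  rw [sep_search1 (admissible hA) _ (by linarith) (by linarith), abs_of_nonneg
    (sin_nonneg_of_nonneg_of_le_pi (by linarith) (by linarith)),
    show (x + (A.p1 + (x - x₂) / 2)) / 2 = (x₂ + A.p1) / 2 + 3 / 4 * (x - x₂) by ring]
  linarith [sin_add_sub_sin_lt (θ := (x₂ + A.p1) / 2) (v := 3 / 4 * (x - x₂)) (by linarith)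
    (by linarith) (by linarith) (by linarith)]

/-- Exits after the first cut of the finder: the partner is picked up on its way into the second
cut. -/
theorem evac_lt_of_p1_lt (hA : A = Params.star) (hq0 : 0.1609 ≤ q) (hq1 : q ≤ 0.1616)
    (hq : 2 - 2 * cos (A.p1 + A.p2) - 2 * q * (sin (A.p1 + A.α2) + sin (A.p2 - A.α2)) + q ^ 2 =
      (A.p2 - A.p1 + q) ^ 2) (hx : A.p1 < x) (hx' : x ≤ A.p1 + 2 * (A.d2 - q) + 0.003) :
    reachTime A x + 2 * delay A x (reachTime A x) <
      1 + A.p1 + 2 * A.d1 + 2 * (A.p2 - A.p1 + q) := by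
  have hA' := admissible hA
  have hp := p1_eq hA
  have hp2 := p2_eq hA
  have hd := d2_eq hA
  have key : ∀ s, 0 < s → s ≤ 2 * (A.d2 - q) →
      sep A (A.p1 + s) (1 + A.p2 + 2 * A.d1 + (q + s / 2)) ^ 2 <
        (A.p2 - A.p1 + q - s / 2) ^ 2 - 0.7 * s := by
    intro s hs0 hs1
    rw [sep_cut2_out_sq hA' _ (by linarith) (by linarith)]
    linarith [cut2_out_ineq hp hp2 (α2_eq hA) hq0 hq1 hs0 (by linarith)]
  rw [reachTime_of_lt_of_le hx (by linarith)]
  refine add_two_mul_delay_lt hA' (t := A.p2 - A.p1 + q - (x - A.p1) / 2)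
    (T := 1 + A.p2 + 2 * A.d1 + (q + (x - A.p1) / 2)) (by ring) (by ring) ?_
  rcases le_or_gt (x - A.p1) (2 * (A.d2 - q)) with h2 | h2
  · have := key (x - A.p1) (by linarith) h2
    rw [add_sub_cancel] at this
    exact lt_of_pow_lt_pow_left₀ 2 (by linarith) (by linarith)
  · -- A margin at the turning point of the partner covers the exits shortly after it.
    have h3 : sep A (A.p1 + 2 * (A.d2 - q)) (1 + A.p2 + 2 * A.d1 + A.d2) <
        A.p2 - A.p1 + q - (A.d2 - q) - 0.006 := by
      refine lt_of_pow_lt_pow_left₀ 2 (by linarith) ?_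
      have := key (2 * (A.d2 - q)) (by linarith) le_rfl
      rw [mul_div_cancel_left₀ _ (two_ne_zero' ℝ), add_sub_cancel] at this
      nlinarith
    have h4 := (abs_le.1 (abs_sep_sub_sep_le hA' x (A.p1 + 2 * (A.d2 - q))
      (1 + A.p2 + 2 * A.d1 + (q + (x - A.p1) / 2)) (1 + A.p2 + 2 * A.d1 + A.d2))).2
    rw [abs_of_pos (by linarith), abs_of_pos (by linarith)] at h4
    linarith

/-- Exits before `E₄`: the partner is picked up on its way back from the second cut. -/
theorem evac_lt_of_lt_x4 (hA : A = Params.star) (hx4 : 2.9722 ≤ x₄) (hx4' : x₄ ≤ 2.9725)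
    (h : x₄ + 2 * sin ((x₄ + A.p2) / 2) = A.p2 + 2 * A.d2) (h0 : x₄ - 2 * A.d2 ≤ x)
    (hx : x < x₄) :
    reachTime A x + 2 * delay A x (reachTime A x) <
      1 + 2 * A.p2 + 2 * A.d1 + 4 * A.d2 - x₄ := by
  have hA' := admissible hA
  have hp := p1_eq hA
  have hp2 := p2_eq hA
  have hd := d2_eq hA
  have hs := two_mul_abs_sin_of_eq (by linarith) (by linarith [pi_gt_three]) h
  have e0 := sep_cut2_back_sq hA' x₄ le_rfl hA'.d2_pos.le
  rw [sub_zero, sep_search2 hA' _ le_rfl, hs] at e0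
  rw [reachTime_of_lt_of_le (by linarith) (by linarith)]
  refine add_two_mul_delay_lt hA' (t := A.p2 + 2 * A.d2 - x₄ + (x₄ - x) / 2)
    (T := 1 + A.p2 + 2 * A.d1 + 2 * A.d2 - (x₄ - x) / 2) (by ring) (by ring) ?_
  refine lt_of_pow_lt_pow_left₀ 2 (by linarith) ?_
  rw [sep_cut2_back_sq hA' _ (by linarith) (by linarith)]
  have := cut2_back_ineq hp2 (α2_eq hA) hd hx4 hx4' (s := x₄ - x) (by linarith) (by linarith)
  rw [sub_sub_cancel] at this
  linarith

/-- Exits after `E₄`: the partner is picked up during its search after the second cut. -/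
theorem evac_lt_of_x4_lt (hA : A = Params.star) (hx4 : 2.9722 ≤ x₄)
    (h : x₄ + 2 * sin ((x₄ + A.p2) / 2) = A.p2 + 2 * A.d2) (hx : x₄ < x) (hx' : x ≤ A.p2) :
    reachTime A x + 2 * delay A x (reachTime A x) <
      1 + 2 * A.p2 + 2 * A.d1 + 4 * A.d2 - x₄ := by
  have hpi := pi_gt_d6
  have hp := p1_eq hA
  have hp2 := p2_eq hA
  have hd := d2_eq hA
  rw [reachTime_of_lt_of_le (by linarith) hx']
  refine add_two_mul_delay_lt (admissible hA) (t := A.p2 + 2 * A.d2 - x₄ - (x - x₄) / 2)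
    (T := 1 + (A.p2 + (x - x₄) / 2) + 2 * A.d1 + 2 * A.d2) (by ring) (by ring) ?_
  rw [sep_search2 (admissible hA) _ (by linarith), abs_of_nonneg
    (sin_nonneg_of_nonneg_of_le_pi (by linarith) (by linarith)),
    show (x + (A.p2 + (x - x₄) / 2)) / 2 = (x₄ + A.p2) / 2 + 3 / 4 * (x - x₄) by ring]
  linarith [sin_add_sub_sin_lt (θ := (x₄ + A.p2) / 2) (v := 3 / 4 * (x - x₄)) (by linarith)
    (by linarith) (by linarith) (by linarith)]

/-- Exits after the second cut of the finder. -/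
theorem evac_lt_of_p2_lt (hA : A = Params.star) (hx : A.p2 < x) (hx' : x ≤ π) :
    reachTime A x + 2 * delay A x (reachTime A x) < 1 + A.p2 + 2 * A.d1 + 2 * A.d2 +
      2 * delay A A.p2 (1 + A.p2 + 2 * A.d1 + 2 * A.d2) := by
  have hpi := pi_gt_d6
  have hpi' := pi_lt_d6
  have hA' := admissible hA
  have hp2 := p2_eq hA
  have hd1 := hA'.d1_pos
  have hd2 := hA'.d2_pos
  have hsep : ∀ x b, A.p2 ≤ b → 0 ≤ x + b → x + b ≤ 2 * π →
      sep A x (1 + b + 2 * A.d1 + 2 * A.d2) = 2 * sin ((x + b) / 2) := by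
    intro x b hb h0 h1
    rw [sep_search2 hA' _ hb, abs_of_nonneg
      (sin_nonneg_of_nonneg_of_le_pi (by linarith) (by linarith))]
  have hle : delay A A.p2 (1 + A.p2 + 2 * A.d1 + 2 * A.d2) ≤ 0.2 := by
    refine delay_le hA' (by norm_num) ?_
    rw [show 1 + A.p2 + 2 * A.d1 + 2 * A.d2 + 0.2 = 1 + (A.p2 + 0.2) + 2 * A.d1 + 2 * A.d2 by ring,
      hsep _ _ (by linarith) (by linarith) (by linarith), ← sin_pi_sub]
    linarith [sin_le (show 0 ≤ π - (A.p2 + (A.p2 + 0.2)) / 2 by linarith)]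
  obtain ⟨hy0, hy⟩ := delay_spec hA' A.p2 (t₀ := 1 + A.p2 + 2 * A.d1 + 2 * A.d2) (by linarith)
  set y := delay A A.p2 (1 + A.p2 + 2 * A.d1 + 2 * A.d2)
  rw [show 1 + A.p2 + 2 * A.d1 + 2 * A.d2 + y = 1 + (A.p2 + y) + 2 * A.d1 + 2 * A.d2 by ring,
    hsep _ _ (by linarith) (by linarith) (by linarith)] at hy
  have hge : 0.16 ≤ y := by
    rw [← sin_pi_sub] at hy
    have hz0 : 0 ≤ π - (A.p2 + (A.p2 + y)) / 2 := by linarith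
    have hz1 : (π - (A.p2 + (A.p2 + y)) / 2) ^ 2 ≤ 0.17 ^ 2 := pow_le_pow_left₀ hz0 (by linarith) 2
    nlinarith [sin_ge_sub_cube hz0, mul_nonneg hz0 (sub_nonneg.2 hz1)]
  rw [reachTime_of_lt hA' hx]
  rcases le_or_gt x (A.p2 + 0.04) with h1 | h1
  · refine add_two_mul_delay_lt hA' (t := y - (x - A.p2) / 2)
      (T := 1 + (A.p2 + y + (x - A.p2) / 2) + 2 * A.d1 + 2 * A.d2) (by ring) (by ring) ?_
    rw [hsep _ _ (by linarith) (by linarith) (by linarith),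
      show (x + (A.p2 + y + (x - A.p2) / 2)) / 2 =
        (A.p2 + (A.p2 + y)) / 2 + 3 / 4 * (x - A.p2) by ring]
    linarith [sin_add_sub_sin_lt (θ := (A.p2 + (A.p2 + y)) / 2) (v := 3 / 4 * (x - A.p2))
      (by linarith) (by linarith) (by linarith) (by linarith)]
  · -- The robots meet at the latest when the partner reaches the antipode of the start point.
    have : delay A x (1 + x + 2 * A.d1 + 2 * A.d2) ≤ π - x := by
      refine delay_le hA' (by linarith) ?_
      rw [show 1 + x + 2 * A.d1 + 2 * A.d2 + (π - x) = 1 + π + 2 * A.d1 + 2 * A.d2 by ring,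
        hsep _ _ (by linarith) (by linarith) (by linarith), ← sin_pi_sub]
      linarith [sin_le (show 0 ≤ π - (x + π) / 2 by linarith)]
    linarith

end

/-! ### Meeting and evacuation times of exit positions -/

/-! ### Meeting and evacuation times of exit positions -/

theorem exists_arcPoint_eq (I E : Circle) : ∃ k, ∃ x ∈ Set.Icc 0 π, arcPoint I k x = E := by
  have h := Circle.exp_arg (I⁻¹ * E)
  set a := Complex.arg ((I⁻¹ * E : Circle) : ℂ)
  rcases le_total 0 a with h0 | h0
  · exact ⟨.R1, a, ⟨h0, Complex.arg_le_pi _⟩, by simp [arcPoint, h]⟩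
  · have := Complex.neg_pi_lt_arg ((I⁻¹ * E : Circle) : ℂ)
    refine ⟨.R2, -a, ⟨by linarith, by linarith⟩, ?_⟩
    simp [arcPoint, h]

theorem evacTime_boundary {A : Params} (hA : A.Admissible) (I : Circle) (k : Robot) {x : ℝ}
    (hx : x ∈ Set.Icc 0 π) : evacTime A I (.boundary (arcPoint I k x)) =
      reachTime A x + 2 * delay A x (reachTime A x) := by
  rw [evacTime, foundAt_boundary hA I k hx, pickupDelay_boundary hA I k hx]

theorem evacTime_afterCut1 (A : Params) (I : Circle) (k : Robot) :
    evacTime A I (.afterCut1 k) =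
      1 + A.p1 + 2 * A.d1 + 2 * delay A A.p1 (1 + A.p1 + 2 * A.d1) := by
  rw [evacTime, pickupDelay_afterCut1, foundAt]

theorem evacTime_afterCut2 (A : Params) (I : Circle) (k : Robot) :
    evacTime A I (.afterCut2 k) = 1 + A.p2 + 2 * A.d1 + 2 * A.d2 +
      2 * delay A A.p2 (1 + A.p2 + 2 * A.d1 + 2 * A.d2) := by
  rw [evacTime, pickupDelay_afterCut2, foundAt]

theorem meetingTime_boundary {A : Params} (hA : A.Admissible) (I : Circle) (k : Robot) {x : ℝ}
    (hx : x ∈ Set.Icc 0 π) : meetingTime A I (.boundary (arcPoint I k x)) =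
      reachTime A x + delay A x (reachTime A x) := by
  rw [meetingTime, foundAt_boundary hA I k hx, pickupDelay_boundary hA I k hx]

/-- If the meeting takes place at time `T`, it is after the exit has been found, and the finder
needs exactly the time in between to get to its partner. -/
theorem sep_of_meeting_eq {A : Params} (hA : A.Admissible) {x T : ℝ} (hx : 0 ≤ x)
    (h : reachTime A x + delay A x (reachTime A x) = T) :
    reachTime A x ≤ T ∧ sep A x T = T - reachTime A x := by
  obtain ⟨h0, h1⟩ := delay_spec hA x (t₀ := reachTime A x) (by linarith [le_reachTime hA x])
  rw [h] at h1
  exact ⟨by linarith, by linarith⟩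

theorem lt_reachTime {A : Params} (hA : A.Admissible) {x : ℝ} (hx : A.p1 < x) :
    1 + A.p1 + 2 * A.d1 < reachTime A x := by
  have := hA.d2_pos
  unfold reachTime
  rw [if_neg hx.not_ge]
  split_ifs <;> linarith

end DiskEvacuation

open DiskEvacuation in
theorem mainTheorem2 (A : DiskEvacuation.Params) (hA : A = DiskEvacuation.Params.star)
    (I : Circle) :
    ∃ x₁ x₂ x₄ : ℝ,
      (0 < x₁ ∧ x₁ < x₂ ∧ x₂ < A.p1 ∧ A.p1 < x₄ ∧ x₄ < A.p2) ∧
      (∀ k : DiskEvacuation.Robot, ∀ x ∈ Set.Icc 0 Real.pi,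
        (DiskEvacuation.meetingTime A I (.boundary (DiskEvacuation.arcPoint I k x)) =
          1 + A.p1 ↔ x = x₁) ∧
        (DiskEvacuation.meetingTime A I (.boundary (DiskEvacuation.arcPoint I k x)) =
          1 + A.p1 + 2 * A.d1 ↔ x = x₂) ∧
        (DiskEvacuation.meetingTime A I (.boundary (DiskEvacuation.arcPoint I k x)) =
          1 + A.p2 + 2 * A.d1 + 2 * A.d2 ↔ x = x₄)) ∧
      (∃ X : DiskEvacuation.ExitPos, DiskEvacuation.IsWorstCase A I X) ∧
      ∀ X : DiskEvacuation.ExitPos, DiskEvacuation.IsWorstCase A I X →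
        ∃ k : DiskEvacuation.Robot,
          X = .boundary (DiskEvacuation.arcPoint I k x₁) ∨
          X = .boundary (DiskEvacuation.arcPoint I k x₂) ∨
          X = .afterCut1 k ∨
          X = .boundary (DiskEvacuation.arcPoint I k x₄) ∨
          X = .afterCut2 k := by
  have hpi := Real.pi_gt_d6
  have hpi' := Real.pi_lt_d6
  have hA' := admissible hA
  have hp1 := p1_eq hA
  have hp2 := p2_eq hA
  have hd1 := d1_eq hA
  have hd2 := d2_eq hA
  have hα1 := α1_eq hA
  have hα2 := α2_eq hA
  obtain ⟨x₁, l1, u1, h1⟩ := exists_x1 hp1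
  obtain ⟨x₂, l2, u2, h2⟩ := exists_x2 hp1 hd1
  obtain ⟨x₄, l4, u4, h4⟩ := exists_x4 hp2 hd2
  obtain ⟨q, lq, uq, hq⟩ := exists_depth hp1 hp2 hα2
  have m1 : x₁ ∈ Set.Icc 0 Real.pi := ⟨by linarith, by linarith⟩
  have m2 : x₂ ∈ Set.Icc 0 Real.pi := ⟨by linarith, by linarith⟩
  have m4 : x₄ ∈ Set.Icc 0 Real.pi := ⟨by linarith, by linarith⟩
  have D1 := delay_x1 hA' (by linarith) (by linarith) h1
  have D2 := delay_x2 hA' (by linarith) (by linarith) h2 (by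
    have := Real.sin_neg_of_neg_of_neg_pi_lt (x := x₂ + A.α1 - 2 * Real.pi) (by linarith)
      (by linarith)
    rw [Real.sin_sub_two_pi] at this
    linarith [Real.sin_le_one (A.p1 - A.α1)])
  have D4 := delay_x4 hA' (by linarith) (by linarith) h4 (by
    have := Real.sin_neg_of_neg_of_neg_pi_lt (x := x₄ + A.α2 - 2 * Real.pi) (by linarith)
      (by linarith)
    rw [Real.sin_sub_two_pi] at this
    have := sin_le_of_pi_sub_le (θ := A.p2 - A.α2) (b := 0.3414) (by linarith) (by linarith)
      (by norm_num)
    norm_num at this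
    linarith)
  have D3 := delay_afterCut1 hA' (by linarith) (by linarith) hq (add_nonneg
    (Real.sin_nonneg_of_nonneg_of_le_pi (by linarith) (by linarith))
    (Real.sin_nonneg_of_nonneg_of_le_pi (by linarith) (by linarith)))
  have R1 := reachTime_of_le (A := A) (x := x₁) (by linarith)
  have R2 := reachTime_of_le (A := A) (x := x₂) (by linarith)
  have R4 := reachTime_of_lt_of_le (A := A) (x := x₄) (by linarith) (by linarith)
  refine ⟨x₁, x₂, x₄, ⟨by linarith, by linarith, by linarith, by linarith, by linarith⟩, ?_, ?_⟩
  · intro k x hx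
    rw [meetingTime_boundary hA' I k hx]
    have hxp1 : 0 ≤ (x + A.p1) / 2 ∧ (x + A.p1) / 2 ≤ Real.pi :=
      ⟨by linarith [hx.1], by linarith [hx.2]⟩
    have hxp2 : 0 ≤ (x + A.p2) / 2 ∧ (x + A.p2) / 2 ≤ Real.pi :=
      ⟨by linarith [hx.1], by linarith [hx.2]⟩
    refine ⟨⟨fun h => ?_, ?_⟩, ⟨fun h => ?_, ?_⟩, ⟨fun h => ?_, ?_⟩⟩
    · obtain ⟨ht, hs⟩ := sep_of_meeting_eq hA' hx.1 h
      have hx' : x ≤ A.p1 := by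
        by_contra! h'
        linarith [lt_reachTime hA' h']
      rw [reachTime_of_le hx', sep_search0 _ hA'.p1_pos.le le_rfl,
        abs_of_nonneg (Real.sin_nonneg_of_nonneg_of_le_pi hxp1.1 hxp1.2)] at hs
      exact (strictMono_add_two_mul_sin A.p1).injective (by linarith)
    · rintro rfl
      rw [D1, R1]; ring
    · obtain ⟨ht, hs⟩ := sep_of_meeting_eq hA' hx.1 h
      have hx' : x ≤ A.p1 := by
        by_contra! h'
        linarith [lt_reachTime hA' h']
      rw [reachTime_of_le hx', sep_search1 hA' _ le_rfl hA'.p1_lt_p2.le,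
        abs_of_nonneg (Real.sin_nonneg_of_nonneg_of_le_pi hxp1.1 hxp1.2)] at hs
      exact (strictMono_add_two_mul_sin A.p1).injective (by linarith)
    · rintro rfl
      rw [D2, R2]; ring
    · obtain ⟨ht, hs⟩ := sep_of_meeting_eq hA' hx.1 h
      have hx' : x ≤ A.p2 := by
        by_contra! h'
        linarith [reachTime_of_lt hA' h']
      rw [sep_search2 hA' _ le_rfl,
        abs_of_nonneg (Real.sin_nonneg_of_nonneg_of_le_pi hxp2.1 hxp2.2)] at hs
      rcases le_or_gt x A.p1 with h3 | h3
      · -- Exits found before the first cut lead to an earlier meeting.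
        have := strictMono_add_two_mul_sin A.p2 (show x < x₄ by linarith)
        rw [reachTime_of_le h3] at hs
        simp only at this
        linarith
      · rw [reachTime_of_lt_of_le h3 hx'] at hs
        exact (strictMono_add_two_mul_sin A.p2).injective (by linarith)
    · rintro rfl
      rw [D4, R4]; ring
  -- No exit position beats all candidates, and one that ties with the best is a candidate.
  set S : Set ExitPos := {.boundary (arcPoint I .R1 x₁), .boundary (arcPoint I .R1 x₂),
    .afterCut1 .R1, .boundary (arcPoint I .R1 x₄), .afterCut2 .R1} with hS
  have V1 : ∀ k, evacTime A I (.boundary (arcPoint I k x₁)) = 1 + 2 * A.p1 - x₁ := fun k => by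
    rw [evacTime_boundary hA' I k m1, D1, R1]; ring
  have V2 : ∀ k, evacTime A I (.boundary (arcPoint I k x₂)) =
      1 + 2 * A.p1 + 4 * A.d1 - x₂ := fun k => by
    rw [evacTime_boundary hA' I k m2, D2, R2]; ring
  have V4 : ∀ k, evacTime A I (.boundary (arcPoint I k x₄)) =
      1 + 2 * A.p2 + 2 * A.d1 + 4 * A.d2 - x₄ := fun k => by
    rw [evacTime_boundary hA' I k m4, D4, R4]; ring
  have key : ∀ X : ExitPos, ∃ W ∈ S, evacTime A I X ≤ evacTime A I W ∧
      (evacTime A I X = evacTime A I W → ∃ k : Robot,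
        X = .boundary (arcPoint I k x₁) ∨ X = .boundary (arcPoint I k x₂) ∨ X = .afterCut1 k ∨
        X = .boundary (arcPoint I k x₄) ∨ X = .afterCut2 k) := by
    have lt : ∀ {e : ℝ} {W : ExitPos} {P : Prop}, W ∈ S → e < evacTime A I W →
        ∃ W ∈ S, e ≤ evacTime A I W ∧ (e = evacTime A I W → P) :=
      fun hW h => ⟨_, hW, h.le, fun h' => absurd h' h.ne⟩
    rintro (E | k | k)
    · obtain ⟨k, x, hx, rfl⟩ := exists_arcPoint_eq I E
      rcases eq_or_ne x x₁ with rfl | n1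
      · exact ⟨.boundary (arcPoint I .R1 x), by simp [hS], by rw [V1, V1], fun _ => ⟨k, by simp⟩⟩
      rcases eq_or_ne x x₂ with rfl | n2
      · exact ⟨.boundary (arcPoint I .R1 x), by simp [hS], by rw [V2, V2], fun _ => ⟨k, by simp⟩⟩
      rcases eq_or_ne x x₄ with rfl | n4
      · exact ⟨.boundary (arcPoint I .R1 x), by simp [hS], by rw [V4, V4], fun _ => ⟨k, by simp⟩⟩
      rw [evacTime_boundary hA' I k hx]
      have V3 : evacTime A I (.afterCut1 .R1) =
          1 + A.p1 + 2 * A.d1 + 2 * (A.p2 - A.p1 + q) := by rw [evacTime_afterCut1, D3]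
      rcases lt_or_gt_of_ne n1 with c1 | c1
      · exact lt (W := .boundary (arcPoint I .R1 x₁)) (by simp [hS])
          ((evac_lt_of_lt_x1 hA l1 u1 h1 hx.1 c1).trans_eq (V1 _).symm)
      rcases le_or_gt x (x₁ + 2 * A.d1 + 0.015) with c2 | c2
      · exact lt (W := .boundary (arcPoint I .R1 x₁)) (by simp [hS])
          ((evac_lt_of_x1_lt hA l1 u1 h1 c1 c2).trans_eq (V1 _).symm)
      rcases lt_or_gt_of_ne n2 with c3 | c3
      · exact lt (W := .boundary (arcPoint I .R1 x₂)) (by simp [hS])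
          ((evac_lt_of_lt_x2 hA l2 u2 h2 (by linarith) c3).trans_eq (V2 _).symm)
      rcases le_or_gt x A.p1 with c4 | c4
      · exact lt (W := .boundary (arcPoint I .R1 x₂)) (by simp [hS])
          ((evac_lt_of_x2_lt hA l2 h2 c3 c4).trans_eq (V2 _).symm)
      rcases le_or_gt x (A.p1 + 2 * (A.d2 - q) + 0.003) with c5 | c5
      · exact lt (W := .afterCut1 .R1) (by simp [hS])
          ((evac_lt_of_p1_lt hA lq uq hq c4 c5).trans_eq V3.symm)
      rcases lt_or_gt_of_ne n4 with c6 | c6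
      · exact lt (W := .boundary (arcPoint I .R1 x₄)) (by simp [hS])
          ((evac_lt_of_lt_x4 hA l4 u4 h4 (by linarith) c6).trans_eq (V4 _).symm)
      rcases le_or_gt x A.p2 with c7 | c7
      · exact lt (W := .boundary (arcPoint I .R1 x₄)) (by simp [hS])
          ((evac_lt_of_x4_lt hA l4 h4 c6 c7).trans_eq (V4 _).symm)
      · exact lt (W := .afterCut2 .R1) (by simp [hS])
          ((evac_lt_of_p2_lt hA c7 hx.2).trans_eq (evacTime_afterCut2 A I .R1).symm)
    · refine ⟨.afterCut1 .R1, by simp [hS], ?_, fun _ => ⟨k, by simp⟩⟩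
      rw [evacTime_afterCut1, evacTime_afterCut1]
    · refine ⟨.afterCut2 .R1, by simp [hS], ?_, fun _ => ⟨k, by simp⟩⟩
      rw [evacTime_afterCut2, evacTime_afterCut2]
  obtain ⟨W, hW, hmax⟩ :=
    Set.exists_max_image S (evacTime A I) (by simp [hS]) ⟨_, Set.mem_insert _ _⟩
  have hworst : IsWorstCase A I W := fun Y => by
    obtain ⟨Z, hZ, hle, -⟩ := key Y
    exact hle.trans (hmax Z hZ)
  refine ⟨⟨W, hworst⟩, fun X hX => ?_⟩
  obtain ⟨Z, hZ, hle, heq⟩ := key X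
  exact heq (hle.antisymm (hX Z))
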